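/- **Setting.** Let $(M^n,g)$ be a Riemannian manifold with Levi-Civita connection $\overline\nabla$, let $1\le k\le n-1$, and let $\alpha=\alpha_0,\alpha_1,\dots,\alpha_N$ be smooth differential forms on $M$, where $\alpha$ is a closed $k$-form and the other degrees are arbitrary. For an endomorphism $X$ of a vector space and an $m$-form $\beta$ on it, put $(X\diamond\beta)(v_1,\dots,v_m)=\sum_i\beta(v_1,\dots,Xv_i,\dots,v_m)$. Assume that $(M,g)$ is equipped with a $\mathrm G$-structure, where $\mathrm G\subset\mathrm{SO}(n)$ is the stabilizer of finitely many forms $a_0,\dots,a_N$ on $\mathbb R^n$, and that $\alpha_0,\dots,\alpha_N$ are the induced forms, that is, $\alpha_j$ is represented by $a_j$ in every adapted frame. Thus $\mathrm G_x=\{P\in\mathrm{SO}(T_xM): P^*\alpha_j|_x=\alpha_j|_x,\ 0\le j\le N\}$ corresponds to $\mathrm G$ in adapted frames at $x$. Assume that $\alpha$ is a *parallel-compliant calibration*, which means that the following hold. 1. At every $x\in M$ the form $\alpha_x$ has comass one: $\alpha_x(e_1,\dots,e_k)\le 1$ for all orthonormal $e_1,\dots,e_k\in T_xM$, with equality for at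 least one such $k$-tuple. An oriented $k$-plane $W\subset T_xM$ is called $\alpha$-calibrated if $\alpha_x|_W=\mathsf{vol}_W$. 2. At every $x\in M$ the group $\mathrm G_x$ acts transitively on the $\alpha$-calibrated $k$-planes of $T_xM$. 3. At every $x\in M$, for some (equivalently, by transitivity, for every) $\alpha$-calibrated $k$-plane $W\subset T_xM$ with stabilizer $\mathrm H_W=\{P\in\mathrm G_x:P(W)=W\}$, the Lie algebras $\mathfrak h_W\subseteq\mathfrak g_x\subseteq\mathfrak{so}(T_xM)=\Lambda^2T_xM$ of $\mathrm H_W$ and $\mathrm G_x$ satisfy $$\mathfrak h_W^{\perp_{\mathfrak g_x}}=\mathfrak g_x\cap(W\otimes W^\perp),$$ where the left hand side is the orthogonal complement of $\mathfrak h_W$ in $\mathfrak g_x$, and $W\otimes W^\perp$ is the space of skew endomorphisms which exchange $W$ and $W^\perp$. 4. $\overline\nabla\alpha_j=0$ for all $0\le j\le N$. Let $\iota:L^k\to M$ be an $\alpha$-calibrated immersed submanifold, that is, an immersion such that for every $x\in L$ the plane $T_xL$ (suitably oriented) is $\alpha$-calibrated. On $E=TM|_L=TL\oplus NL$ let $\widehat\nabla=\nabla\oplus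 D$ be the direct sum of the induced tangent and normal connections $\nabla=\pi_{TL}\circ\overline\nabla$ on $TL$ and $D=\pi_{NL}\circ\overline\nabla$ on $NL$. For $u\in T_xL$ let $A_u:T_xL\to N_xL$, $A_uv=\pi_{NL}(\overline\nabla_uv)$, be given by the second fundamental form, and let $B_u$ be the endomorphism $B_u(v,\xi)=(-A_u^*\xi,\,A_uv)$ of $T_xM=T_xL\oplus N_xL$. **Theorem.** For every $0\le j\le N$ one has $$\widehat\nabla\alpha_j=0\qquad\text{and}\qquad B_u\diamond\alpha_j=0\quad\text{for every tangent vector }u\text{ of }L .$$ Consequently, for every $x\in L$, with $\mathrm H_x=\{P\in\mathrm G_x:P(T_xL)=T_xL\}$ and $\mathfrak h_x$ its Lie algebra, the restricted holonomy group of $\widehat\nabla$ at $x$ satisfies $\mathrm{Hol}^0(\widehat\nabla)\subset\mathrm H_x$, so that $\mathfrak{hol}(\widehat\nabla)\subset\mathfrak h_x$; and $B_u\in\mathfrak g_x$ for every $u\in T_xL$. -/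

import Mathlib

open Bundle
open scoped Manifold ContDiff Bundle InnerProductSpace

set_option linter.unusedSectionVars false

noncomputable section

namespace Calibrated

/-! ### Linear algebra of calibrations on a Euclidean space `V` -/

section LinearAlgebra

variable {V : Type*} [NormedAddCommGroup V] [InnerProductSpace ℝ V]

/-- The Lie algebra of a matrix group `S` of endomorphisms of `V`: all `X` whose one-parameter
group `t ↦ exp (t X)` lies in `S`. -/
def lieAlg (S : Set (V →L[ℝ] V)) : Set (V →L[ℝ] V) :=
  {X | ∀ t : ℝ, NormedSpace.exp (t • X) ∈ S}

/-- The infinitesimal action of an endomorphism on an alternating form: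
`(X ⋄ β)(v₁, …, vₘ) = ∑ i, β (v₁, …, X vᵢ, …, vₘ)`. -/
def diamond {m : ℕ} (X : V →L[ℝ] V) (β : V [⋀^Fin m]→L[ℝ] ℝ) (v : Fin m → V) : ℝ :=
  ∑ i, β (Function.update v i (X (v i)))

/-- The comass-one condition: `β (e₁, …, eₖ) ≤ 1` for all orthonormal `e₁, …, eₖ`, with equality
attained. (Orthonormal `k`-frames are oriented orthonormal bases of oriented `k`-planes.) -/
def IsComassOne {k : ℕ} (β : V [⋀^Fin k]→L[ℝ] ℝ) : Prop :=
  (∀ e : Fin k → V, Orthonormal ℝ e → β e ≤ 1) ∧ ∃ e : Fin k → V, Orthonormal ℝ e ∧ β e = 1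

/-- `W` is a `k`-plane which, with a suitable orientation, is calibrated by `β`: the restriction of
`β` to `W` takes the value `1` on some orthonormal basis of `W`, hence is the volume form of `W`
for the orientation given by that basis. -/
def IsCalibratedPlane {k : ℕ} (β : V [⋀^Fin k]→L[ℝ] ℝ) (W : Submodule ℝ V) : Prop :=
  ∃ e : OrthonormalBasis (Fin k) ℝ W, β (fun i => (e i : V)) = 1

variable {N : ℕ} {deg : Fin (N + 1) → ℕ}

/-- The group `G`: the stabilizer in `SO(V)` of the forms `a₀, …, a_N`. -/
def stabGroup (a : ∀ j, V [⋀^Fin (deg j)]→L[ℝ] ℝ) : Set (V →L[ℝ] V) :=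
  {P | (∀ v w, ⟪P v, P w⟫_ℝ = ⟪v, w⟫_ℝ) ∧ P.det = 1 ∧
    ∀ j (v : Fin (deg j) → V), a j (fun i => P (v i)) = a j v}

/-- The group `H_W`: the stabilizer of the plane `W` in `G`. -/
def stabPlane (a : ∀ j, V [⋀^Fin (deg j)]→L[ℝ] ℝ) (W : Submodule ℝ V) : Set (V →L[ℝ] V) :=
  {P | P ∈ stabGroup a ∧ W.map (P : V →ₗ[ℝ] V) = W}

/-- `G` acts transitively on the planes calibrated by `a₀`. -/
def ActsTransitively (a : ∀ j, V [⋀^Fin (deg j)]→L[ℝ] ℝ) : Prop :=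
  ∀ W W' : Submodule ℝ V, IsCalibratedPlane (a 0) W → IsCalibratedPlane (a 0) W' →
    ∃ P ∈ stabGroup a, W.map (P : V →ₗ[ℝ] V) = W'

/-- The subspace `W ⊗ Wᗮ` of `𝔰𝔬(V) = Λ² V`: the skew endomorphisms which exchange `W` and `Wᗮ`. -/
def offDiagonal (W : Submodule ℝ V) : Set (V →L[ℝ] V) :=
  {X | (∀ v w, ⟪X v, w⟫_ℝ = - ⟪v, X w⟫_ℝ) ∧ (∀ v ∈ W, X v ∈ Wᗮ) ∧ ∀ v ∈ Wᗮ, X v ∈ W}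

variable [FiniteDimensional ℝ V]

/-- The inner product `tr (Xᵀ Y)` of endomorphisms. -/
def endInner (X Y : V →L[ℝ] V) : ℝ :=
  ∑ i, ⟪X (stdOrthonormalBasis ℝ V i), Y (stdOrthonormalBasis ℝ V i)⟫_ℝ

/-- Compliancy with respect to `W`: the orthogonal complement of `𝔥` in `𝔤` is
`𝔤 ∩ (W ⊗ Wᗮ)`. -/
def IsCompliantAt (a : ∀ j, V [⋀^Fin (deg j)]→L[ℝ] ℝ) (W : Submodule ℝ V) : Prop :=
  {X | X ∈ lieAlg (stabGroup a) ∧ ∀ Y ∈ lieAlg (stabPlane a W), endInner X Y = 0} =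
    lieAlg (stabGroup a) ∩ offDiagonal W

/-- `a₀` is a compliant calibration on `V` (with respect to the family `a₀, …, a_N`): it has comass
one, `G` acts transitively on the calibrated planes, and compliancy holds for a calibrated plane
(equivalently, by transitivity, for all of them). -/
structure IsCompliant (a : ∀ j, V [⋀^Fin (deg j)]→L[ℝ] ℝ) : Prop where
  comass : IsComassOne (a 0)
  transitive : ActsTransitively a
  compliant : ∃ W, IsCalibratedPlane (a 0) W ∧ IsCompliantAt a W

end LinearAlgebra

/-! ### Connections on vector bundles, parallel forms and holonomy -/

section Connections

variable {EB : Type*} [NormedAddCommGroup EB] [NormedSpace ℝ EB]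
  {HB : Type*} [TopologicalSpace HB] (IB : ModelWithCorners ℝ EB HB)
  {B : Type*} [TopologicalSpace B] [ChartedSpace HB B]
  (F : Type*) [NormedAddCommGroup F] [NormedSpace ℝ F]
  {V : B → Type*} [TopologicalSpace (TotalSpace F V)]
  [∀ x, AddCommGroup (V x)] [∀ x, Module ℝ (V x)] [∀ x, TopologicalSpace (V x)]
  [∀ x, IsTopologicalAddGroup (V x)] [∀ x, ContinuousSMul ℝ (V x)]
  [FiberBundle F V] [VectorBundle ℝ F V]

variable {EN : Type*} [NormedAddCommGroup EN] [NormedSpace ℝ EN]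
  {HN : Type*} [TopologicalSpace HN] (IN : ModelWithCorners ℝ EN HN)
  {N : Type*} [TopologicalSpace N] [ChartedSpace HN N]

/-! Sections of the pullback bundle `f^* V` over `N`, for a map `f : N → B`, are dependent functions
`s : ∀ y : N, V (f y)`; such a section is differentiable (continuous) if it is so as a map
`y ↦ ⟨f y, s y⟩` into the total space of `V`. A connection `D` on `f^* V` sends `s` to
`u ↦ D_u s`. The case `f = id` is that of the bundle `V` itself. -/

section Along

variable {f : N → B}

/-- A fibrewise alternating form `β` on the bundle `f^* V` is parallel for the connection `D` on
`f^* V`: `u (β (s₁, …, sₘ)) = ∑ i, β (s₁, …, D_u sᵢ, …, sₘ)`. -/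
def IsParallelForm (D : (∀ y, V (f y)) → ∀ y : N, TangentSpace IN y →L[ℝ] V (f y)) {m : ℕ}
    (β : ∀ y, V (f y) [⋀^Fin m]→L[ℝ] ℝ) : Prop :=
  ∀ (x : N) (u : TangentSpace IN x) (s : Fin m → ∀ y, V (f y)),
    (∀ i, MDifferentiableAt IN (IB.prod 𝓘(ℝ, F)) (fun y => TotalSpace.mk' F (f y) (s i y)) x) →
    mvfderiv IN (fun y => β y (fun i => s i y)) x u =
      ∑ i, β x (Function.update (fun i => s i x) i (D (s i) x u))

/-- The extension of a vector `v ∈ V (f x)` to a local section of `f^* V` around `x` which is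
constant in the preferred trivialization of `V` at `f x`. -/
def localExt (f : N → B) {x : N} (v : V (f x)) (y : N) : V (f y) :=
  (trivializationAt F V (f x)).symmL ℝ (f y)
    ((trivializationAt F V (f x)).continuousLinearMapAt ℝ (f x) v)

variable {EP : Type*} [NormedAddCommGroup EP] [NormedSpace ℝ EP]
  {HP : Type*} [TopologicalSpace HP] (IP : ModelWithCorners ℝ EP HP)
  {P : Type*} [TopologicalSpace P] [ChartedSpace HP P]

/-- The pullback `g^* D` of a connection `D` on `f^* V` along `g : P → N`, applied to a section `s`
of `g^* f^* V`: in the preferred trivialization `Φ` of `V` at `f (g p)`,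
`(g^* D)_u s = Φ⁻¹ (u (Φ s)) + D_{g_* u} (Φ⁻¹ c)`, where `c = Φ (s p)` is frozen, so that
`Φ⁻¹ c` is the local section `localExt F f (s p)`. It is the connection characterized by
`(g^* D)_u (σ ∘ g) = D_{g_* u} σ` for sections `σ` of `f^* V`. -/
def pullbackConnection (D : (∀ y, V (f y)) → ∀ y : N, TangentSpace IN y →L[ℝ] V (f y)) (g : P → N)
    (s : ∀ p, V (f (g p))) (p : P) : TangentSpace IP p →L[ℝ] V (f (g p)) :=
  (trivializationAt F V (f (g p))).symmL ℝ (f (g p)) ∘L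
      mvfderiv IP (fun q =>
        (trivializationAt F V (f (g p))).continuousLinearMapAt ℝ (f (g q)) (s q)) p +
    D (localExt F f (s p)) (g p) ∘L mfderiv IP IN g p

/-- A continuous curve which is smooth on each closed subinterval of `[0, 1]` whose interior avoids
the finite set `S`. -/
def IsPiecewiseSmooth (γ : ℝ → N) (S : Finset ℝ) : Prop :=
  ContinuousOn γ (Set.Icc 0 1) ∧
    ∀ a b : ℝ, 0 ≤ a → a < b → b ≤ 1 → (∀ t ∈ S, t ∉ Set.Ioo a b) →
      ContMDiffOn 𝓘(ℝ, ℝ) IN ∞ γ (Set.Icc a b)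

/-- `s` is a `D`-parallel section of `f^* V` along the curve `γ : [0, 1] → N`, which is smooth off
`S`. -/
def IsParallelAlong (D : (∀ y, V (f y)) → ∀ y : N, TangentSpace IN y →L[ℝ] V (f y))
    (γ : ℝ → N) (S : Finset ℝ) (s : ∀ t, V (f (γ t))) : Prop :=
  ContinuousOn (fun t => TotalSpace.mk' F (f (γ t)) (s t)) (Set.Icc 0 1) ∧
    ∀ t ∈ Set.Ioo (0 : ℝ) 1, t ∉ S →
      MDifferentiableAt 𝓘(ℝ, ℝ) (IB.prod 𝓘(ℝ, F)) (fun t => TotalSpace.mk' F (f (γ t)) (s t)) t ∧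
        pullbackConnection F IN 𝓘(ℝ, ℝ) D γ s t = 0

/-- The restricted holonomy group `Hol⁰` at `x` of a connection `D` on `f^* V`: the parallel
transports around piecewise smooth null-homotopic loops at `x`. -/
def restrictedHolonomy (D : (∀ y, V (f y)) → ∀ y : N, TangentSpace IN y →L[ℝ] V (f y)) (x : N) :
    Set (V (f x) →L[ℝ] V (f x)) :=
  {T | ∃ (γ : Path x x) (S : Finset ℝ), γ.Homotopic (Path.refl x) ∧
    IsPiecewiseSmooth IN γ.extend S ∧
    ∀ v : V (f x), ∃ s : ∀ t, V (f (γ.extend t)), IsParallelAlong IB F IN D γ.extend S s ∧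
      TotalSpace.mk' F (f (γ.extend 0)) (s 0) = TotalSpace.mk' F (f x) v ∧
      TotalSpace.mk' F (f (γ.extend 1)) (s 1) = TotalSpace.mk' F (f x) (T v)}

end Along

theorem localExt_add (f : N → B) {x : N} (v w : V (f x)) :
    localExt F f (v + w) = localExt F f v + localExt F f w := by
  funext y
  simp [localExt]

theorem localExt_smul (f : N → B) {x : N} (c : ℝ) (v : V (f x)) :
    localExt F f (c • v) = c • localExt F f v := by
  funext y
  simp [localExt]

theorem mdifferentiableAt_localExt [ContMDiffVectorBundle 1 F V IB] {x : B} (v : V x) :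
    MDifferentiableAt IB (IB.prod 𝓘(ℝ, F))
      (fun y => TotalSpace.mk' F y (localExt F (fun x : B => x) v y)) x := by
  have hx := FiberBundle.mem_baseSet_trivializationAt' (F := F) (E := V) x
  refine (FiberBundle.mdifferentiableAt_extend IB F v).congr_of_eventuallyEq ?_
  filter_upwards [(trivializationAt F V x).open_baseSet.mem_nhds hx] with y hy
  congr 1
  have h1 : (trivializationAt F V x).continuousLinearMapAt ℝ x v =
      (trivializationAt F V x ⟨x, v⟩).2 := by
    simp [Trivialization.continuousLinearMapAt_apply, Trivialization.linearMapAt_apply, hx]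
  rw [localExt, h1, Trivialization.symmL_apply _ hy]
  rfl

section Pullback

variable {IB IN}
variable {D : (∀ x, V x) → ∀ x : B, TangentSpace IB x →L[ℝ] V x}
  {f : N → B} {s s' : ∀ y, V (f y)} {y : N}

theorem mdifferentiableAt_localRep
    (hs : MDifferentiableAt IN (IB.prod 𝓘(ℝ, F)) (fun z => TotalSpace.mk' F (f z) (s z)) y) :
    MDifferentiableAt IN 𝓘(ℝ, F)
      (fun z => (trivializationAt F V (f y)).continuousLinearMapAt ℝ (f z) (s z)) y := by
  rw [mdifferentiableAt_totalSpace] at hs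
  obtain ⟨hf, hs⟩ := hs
  refine hs.congr_of_eventuallyEq ?_
  have hb : (trivializationAt F V (f y)).baseSet ∈ nhds (f y) :=
    (trivializationAt F V (f y)).open_baseSet.mem_nhds
      (FiberBundle.mem_baseSet_trivializationAt' (f y))
  filter_upwards [hf.continuousAt.preimage_mem_nhds hb] with z hz
  have hz' : f z ∈ (trivializationAt F V (f y)).baseSet := hz
  simp [Trivialization.continuousLinearMapAt_apply, Trivialization.linearMapAt_apply, hz']

variable [ContMDiffVectorBundle 1 F V IB]

theorem pullbackConnection_add (hD : IsCovariantDerivativeOn F D)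
    (hs : MDifferentiableAt IN (IB.prod 𝓘(ℝ, F)) (fun z => TotalSpace.mk' F (f z) (s z)) y)
    (hs' : MDifferentiableAt IN (IB.prod 𝓘(ℝ, F)) (fun z => TotalSpace.mk' F (f z) (s' z)) y) :
    pullbackConnection F (f := fun x : B => x) IB IN D f (fun z => s z + s' z) y =
      pullbackConnection F (f := fun x : B => x) IB IN D f s y + pullbackConnection F (f := fun x : B => x) IB IN D f s' y := by
  have h1 := mdifferentiableAt_localRep (F := F) hs
  have h2 := mdifferentiableAt_localRep (F := F) hs'
  have h3 := mvfderiv_add h1 h2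
  have h4 := hD.add (mdifferentiableAt_localExt IB F (s y)) (mdifferentiableAt_localExt IB F (s' y))
  have h5 : (fun z => (trivializationAt F V (f y)).continuousLinearMapAt ℝ (f z) (s z + s' z)) =
    (fun z => (trivializationAt F V (f y)).continuousLinearMapAt ℝ (f z) (s z)) +
    (fun z => (trivializationAt F V (f y)).continuousLinearMapAt ℝ (f z) (s' z)) := by
    funext z; simp
  unfold pullbackConnection
  rw [localExt_add, h4, h5, h3]
  ext u
  simp
  abel

theorem pullbackConnection_smul (hD : IsCovariantDerivativeOn F D)
    (hs : MDifferentiableAt IN (IB.prod 𝓘(ℝ, F)) (fun z => TotalSpace.mk' F (f z) (s z)) y)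
    (c : ℝ) :
    pullbackConnection F (f := fun x : B => x) IB IN D f (fun z => c • s z) y =
      c • pullbackConnection F (f := fun x : B => x) IB IN D f s y := by
  have h1 := mdifferentiableAt_localRep (F := F) hs
  have h3 := mvfderiv_smul (mdifferentiableAt_const (c := c)) h1
  have h4 := hD.smul_const c (mdifferentiableAt_localExt IB F (s y))
  have h5 : (fun z => (trivializationAt F V (f y)).continuousLinearMapAt ℝ (f z) (c • s z)) =
    (fun _ : N => c) • (fun z => (trivializationAt F V (f y)).continuousLinearMapAt ℝ (f z) (s z)) := by
    funext z; simp
  unfold pullbackConnection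
  rw [localExt_smul, h4, h5, h3, mvfderiv_const]
  ext u
  simp

end Pullback

end Connections

/-! ### Differential forms and the Levi-Civita connection -/

section Forms

variable {n : ℕ} {M : Type*} [TopologicalSpace M] [ChartedSpace (EuclideanSpace ℝ (Fin n)) M]

/-- The local expression of an `m`-form in the preferred chart at `x₀`: the pullback by the inverse
of the chart. -/
def formInChart {m : ℕ} (β : ∀ x : M, TangentSpace (𝓡 n) x [⋀^Fin m]→L[ℝ] ℝ) (x₀ : M)
    (y : EuclideanSpace ℝ (Fin n)) : EuclideanSpace ℝ (Fin n) [⋀^Fin m]→L[ℝ] ℝ :=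
  (β ((extChartAt (𝓡 n) x₀).symm y)).compContinuousLinearMap
    (mfderiv 𝓘(ℝ, EuclideanSpace ℝ (Fin n)) (𝓡 n) (extChartAt (𝓡 n) x₀).symm y)

/-- Smooth differential forms. -/
def IsSmoothForm {m : ℕ} (β : ∀ x : M, TangentSpace (𝓡 n) x [⋀^Fin m]→L[ℝ] ℝ) : Prop :=
  ∀ x₀ : M, ContDiffOn ℝ ∞ (formInChart β x₀) (extChartAt (𝓡 n) x₀).target

/-- Closed differential forms. -/
def IsClosedForm {m : ℕ} (β : ∀ x : M, TangentSpace (𝓡 n) x [⋀^Fin m]→L[ℝ] ℝ) : Prop :=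
  ∀ x₀ : M, ∀ y ∈ (extChartAt (𝓡 n) x₀).target, extDeriv (formInChart β x₀) y = 0

variable [IsManifold (𝓡 n) ∞ M] [RiemannianBundle (fun x : M => TangentSpace (𝓡 n) x)]
  [IsContMDiffRiemannianBundle (𝓡 n) ∞ (EuclideanSpace ℝ (Fin n))
    (fun x : M => TangentSpace (𝓡 n) x)]

instance instFiniteDimensionalTangentSpace (x : M) :
    FiniteDimensional ℝ (TangentSpace (𝓡 n) x) :=
  inferInstanceAs (FiniteDimensional ℝ (EuclideanSpace ℝ (Fin n)))

instance instIsContMDiffRiemannianBundleOne : IsContMDiffRiemannianBundle (𝓡 n) 1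
    (EuclideanSpace ℝ (Fin n)) (fun x : M => TangentSpace (𝓡 n) x) :=
  IsContMDiffRiemannianBundle.of_le (n := ∞) (by norm_cast)

/-- The Levi-Civita connection: the smooth, torsion-free, metric connection on `TM`. -/
structure IsLeviCivita (nabla : CovariantDerivative (𝓡 n) (EuclideanSpace ℝ (Fin n))
    (fun x : M => TangentSpace (𝓡 n) x)) : Prop where
  smooth : nabla.ContMDiffCovariantDerivative ∞
  torsionFree : nabla.torsion = 0
  metric : nabla.IsMetricCompatible

variable {N : ℕ} {deg : Fin (N + 1) → ℕ}

/-- A `G`-structure on `(M, g)`, where `G ⊆ SO(n)` is the stabilizer of the forms `a₀, …, a_N` on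
`ℝⁿ`, together with the induced forms `α₀, …, α_N` on `M`. The set `Q x` consists of the adapted
frames at `x`, viewed as isometries `ℝⁿ → T_x M`; it is an orbit of `G`, and `Q` has smooth local
sections. In every adapted frame `α_j` is represented by `a_j`. -/
structure IsGStructure (a : ∀ j, EuclideanSpace ℝ (Fin n) [⋀^Fin (deg j)]→L[ℝ] ℝ)
    (α : ∀ j, ∀ x : M, TangentSpace (𝓡 n) x [⋀^Fin (deg j)]→L[ℝ] ℝ)
    (Q : ∀ x : M, Set (EuclideanSpace ℝ (Fin n) ≃ₗᵢ[ℝ] TangentSpace (𝓡 n) x)) : Prop where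
  orbit : ∀ x, ∀ p ∈ Q x, ∀ q : EuclideanSpace ℝ (Fin n) ≃ₗᵢ[ℝ] TangentSpace (𝓡 n) x,
    q ∈ Q x ↔ ((q.trans p.symm).toContinuousLinearEquiv :
      EuclideanSpace ℝ (Fin n) →L[ℝ] EuclideanSpace ℝ (Fin n)) ∈ stabGroup a
  local_section : ∀ x₀ : M, ∃ U : Set M, IsOpen U ∧ x₀ ∈ U ∧
    ∃ p : ∀ x : M, EuclideanSpace ℝ (Fin n) ≃ₗᵢ[ℝ] TangentSpace (𝓡 n) x,
      (∀ x ∈ U, p x ∈ Q x) ∧ ∀ v, ContMDiffOn (𝓡 n) ((𝓡 n).prod 𝓘(ℝ, EuclideanSpace ℝ (Fin n))) ∞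
        (fun x => TotalSpace.mk' (EuclideanSpace ℝ (Fin n)) x (p x v)) U
  forms : ∀ x, ∀ p ∈ Q x, ∀ j v, α j x (fun i => p (v i)) = a j v

/-- `α = α₀` is a parallel-compliant calibration on `(M, g)` with respect to the forms
`α₀, …, α_N`, where `nabla` is the Levi-Civita connection. -/
structure IsParallelCompliant (nabla : CovariantDerivative (𝓡 n) (EuclideanSpace ℝ (Fin n))
    (fun x : M => TangentSpace (𝓡 n) x))
    (α : ∀ j, ∀ x : M, TangentSpace (𝓡 n) x [⋀^Fin (deg j)]→L[ℝ] ℝ) : Prop where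
  smooth : ∀ j, IsSmoothForm (α j)
  closed : IsClosedForm (α 0)
  gStructure : ∃ a Q, IsGStructure a α Q
  compliant : ∀ x, IsCompliant (fun j => α j x)
  parallel : ∀ j, IsParallelForm (𝓡 n) (EuclideanSpace ℝ (Fin n)) (𝓡 n)
    (f := fun x : M => x) nabla (α j)

end Forms

/-! ### Immersed submanifolds -/

section Submanifold

variable {n : ℕ} {M : Type*} [TopologicalSpace M] [ChartedSpace (EuclideanSpace ℝ (Fin n)) M]
  [IsManifold (𝓡 n) ∞ M] [RiemannianBundle (fun x : M => TangentSpace (𝓡 n) x)]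
  {k : ℕ} {L : Type*} [TopologicalSpace L] [ChartedSpace (EuclideanSpace ℝ (Fin k)) L]
  [IsManifold (𝓡 k) ∞ L]

/-- The tangent plane `T_x L`, as a subspace of `T_{ι x} M`. -/
def tangentPlane (ι : C^∞⟮𝓡 k, L; 𝓡 n, M⟯) (x : L) : Submodule ℝ (TangentSpace (𝓡 n) (ι x)) :=
  LinearMap.range (mfderiv (𝓡 k) (𝓡 n) ι x : TangentSpace (𝓡 k) x →ₗ[ℝ] TangentSpace (𝓡 n) (ι x))

instance instFiniteDimensionalTangentPlane (ι : C^∞⟮𝓡 k, L; 𝓡 n, M⟯) (x : L) :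
   FiniteDimensional ℝ (tangentPlane ι x) := inferInstance

/-- The orthogonal projection of `T_{ι x} M` onto `T_x L`. -/
def projT (ι : C^∞⟮𝓡 k, L; 𝓡 n, M⟯) (x : L) :
    TangentSpace (𝓡 n) (ι x) →L[ℝ] TangentSpace (𝓡 n) (ι x) :=
  (tangentPlane ι x).starProjection

/-- The orthogonal projection of `T_{ι x} M` onto the normal space `N_x L`. -/
def projN (ι : C^∞⟮𝓡 k, L; 𝓡 n, M⟯) (x : L) :
    TangentSpace (𝓡 n) (ι x) →L[ℝ] TangentSpace (𝓡 n) (ι x) :=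
  (tangentPlane ι x)ᗮ.starProjection

/-- The connection `∇̄` on `E = TM|_L = ι^* TM` induced by a connection on `TM`. -/
def connE (nabla : CovariantDerivative (𝓡 n) (EuclideanSpace ℝ (Fin n))
    (fun x : M => TangentSpace (𝓡 n) x)) (ι : C^∞⟮𝓡 k, L; 𝓡 n, M⟯)
    (s : ∀ x : L, TangentSpace (𝓡 n) (ι x)) (x : L) :
    TangentSpace (𝓡 k) x →L[ℝ] TangentSpace (𝓡 n) (ι x) :=
  pullbackConnection (EuclideanSpace ℝ (Fin n)) (f := fun x : M => x) (𝓡 n) (𝓡 k) nabla ι s x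

/-- The direct sum connection `∇̂ = ∇ ⊕ D` on `E = TL ⊕ NL`, where `∇ = π_{TL} ∘ ∇̄` on `TL` and
`D = π_{NL} ∘ ∇̄` on `NL`. -/
def connHat (nabla : CovariantDerivative (𝓡 n) (EuclideanSpace ℝ (Fin n))
    (fun x : M => TangentSpace (𝓡 n) x)) (ι : C^∞⟮𝓡 k, L; 𝓡 n, M⟯)
    (s : ∀ x : L, TangentSpace (𝓡 n) (ι x)) (x : L) :
    TangentSpace (𝓡 k) x →L[ℝ] TangentSpace (𝓡 n) (ι x) :=
  projT ι x ∘L connE nabla ι (fun y => projT ι y (s y)) x +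
    projN ι x ∘L connE nabla ι (fun y => projN ι y (s y)) x

theorem mdifferentiableAt_pushforward (ι : C^∞⟮𝓡 k, L; 𝓡 n, M⟯) {x : L}
    (v : TangentSpace (𝓡 k) x) :
    MDifferentiableAt (𝓡 k) ((𝓡 n).prod 𝓘(ℝ, EuclideanSpace ℝ (Fin n)))
      (fun y => TotalSpace.mk' (EuclideanSpace ℝ (Fin n)) (ι y)
        (mfderiv (𝓡 k) (𝓡 n) ι y (localExt (EuclideanSpace ℝ (Fin k)) (fun x : L => x) v y))) x := by
  have h1 : ContMDiff (𝓡 k).tangent (𝓡 n).tangent 1 (tangentMap (𝓡 k) (𝓡 n) ι) :=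
    ι.contMDiff.contMDiff_tangentMap (by norm_cast)
  have h2 := mdifferentiableAt_localExt (𝓡 k) (EuclideanSpace ℝ (Fin k)) v
  exact MDifferentiableAt.comp x ((h1.mdifferentiable one_ne_zero) _) h2

/-- The second fundamental form `A (u, v) = π_{NL} (∇̄_u v)`, as a linear map in `v ∈ T_x L` with
values in `N_x L`; the vector `v` is extended to a local vector field on `L`. -/
def secondFF (nabla : CovariantDerivative (𝓡 n) (EuclideanSpace ℝ (Fin n))
    (fun x : M => TangentSpace (𝓡 n) x)) (ι : C^∞⟮𝓡 k, L; 𝓡 n, M⟯) (x : L)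
    (u : TangentSpace (𝓡 k) x) :
    TangentSpace (𝓡 k) x →ₗ[ℝ] ((tangentPlane ι x)ᗮ : Submodule ℝ (TangentSpace (𝓡 n) (ι x))) where
  toFun v := (tangentPlane ι x)ᗮ.orthogonalProjectionOnto (connE nabla ι
    (fun y => mfderiv (𝓡 k) (𝓡 n) ι y (localExt (EuclideanSpace ℝ (Fin k)) (fun x : L => x) v y)) x u)
  map_add' v w := by
    have h := pullbackConnection_add (EuclideanSpace ℝ (Fin n)) nabla.isCovariantDerivativeOn
      (mdifferentiableAt_pushforward ι v) (mdifferentiableAt_pushforward ι w)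
    rw [← map_add]
    congr 1
    rw [localExt_add]
    simp only [connE, Pi.add_apply, map_add]
    rw [h]
    rfl
  map_smul' c v := by
    have h := pullbackConnection_smul (EuclideanSpace ℝ (Fin n)) nabla.isCovariantDerivativeOn
      (mdifferentiableAt_pushforward ι v) c
    rw [← map_smul]
    congr 1
    rw [localExt_smul]
    simp only [connE, Pi.smul_apply, map_smul]
    rw [h]
    rfl

/-- The map `A_u : T_x L → N_x L`, `A_u v = A (u, v)`, where `T_x L` is identified with its image in
`T_{ι x} M`. -/
def shapeMap (nabla : CovariantDerivative (𝓡 n) (EuclideanSpace ℝ (Fin n))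
    (fun x : M => TangentSpace (𝓡 n) x)) (ι : C^∞⟮𝓡 k, L; 𝓡 n, M⟯)
    (hι : ∀ x, Function.Injective (mfderiv (𝓡 k) (𝓡 n) ι x)) (x : L) (u : TangentSpace (𝓡 k) x) :
    tangentPlane ι x →ₗ[ℝ] ((tangentPlane ι x)ᗮ : Submodule ℝ (TangentSpace (𝓡 n) (ι x))) :=
  secondFF nabla ι x u ∘ₗ (LinearEquiv.ofInjective
    (mfderiv (𝓡 k) (𝓡 n) ι x : TangentSpace (𝓡 k) x →ₗ[ℝ] TangentSpace (𝓡 n) (ι x)) (hι x)).symm.toLinearMap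

/-- The packaged second fundamental form `B_u (v, ξ) = (- A_u^* ξ, A_u v)`, an endomorphism of
`T_{ι x} M = T_x L ⊕ N_x L`. -/
def packagedFF (nabla : CovariantDerivative (𝓡 n) (EuclideanSpace ℝ (Fin n))
    (fun x : M => TangentSpace (𝓡 n) x)) (ι : C^∞⟮𝓡 k, L; 𝓡 n, M⟯)
    (hι : ∀ x, Function.Injective (mfderiv (𝓡 k) (𝓡 n) ι x)) (x : L) (u : TangentSpace (𝓡 k) x) :
    TangentSpace (𝓡 n) (ι x) →L[ℝ] TangentSpace (𝓡 n) (ι x) :=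
  (tangentPlane ι x)ᗮ.subtypeL ∘L (shapeMap nabla ι hι x u).toContinuousLinearMap ∘L
      (tangentPlane ι x).orthogonalProjectionOnto -
    (tangentPlane ι x).subtypeL ∘L (shapeMap nabla ι hι x u).adjoint.toContinuousLinearMap ∘L
      (tangentPlane ι x)ᗮ.orthogonalProjectionOnto

/-- The restricted holonomy group `Hol⁰ (∇̂)` at `x ∈ L`, acting on `T_{ι x} M`. -/
def holHat (nabla : CovariantDerivative (𝓡 n) (EuclideanSpace ℝ (Fin n))
    (fun x : M => TangentSpace (𝓡 n) x)) (ι : C^∞⟮𝓡 k, L; 𝓡 n, M⟯) (x : L) :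
    Set (TangentSpace (𝓡 n) (ι x) →L[ℝ] TangentSpace (𝓡 n) (ι x)) :=
  restrictedHolonomy (𝓡 n) (EuclideanSpace ℝ (Fin n)) (𝓡 k) (connHat nabla ι) x

end Submanifold
end Calibrated
end

/-! Write `π` for the orthogonal projection of `TM|_L` onto `TL`. Everything follows from one
statement: for each `u ∈ T_xL` there is an `X ∈ 𝔤_x`, exchanging `T_xL` and `N_xL`, with `∇̄_u π =
[X, π]` (`IsParallelCompliant.exists_projectionGenerator`). An off-diagonal skew `X` with this
property has to be `B_u`, and `∇̂_u = ∇̄_u - X`. Hence `B_u` annihilates every `α_j`, and `∇̂α_j =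
0` because `∇̄α_j = 0`.

To find `X`, trivialize `TM|_L` near `x` by adapted frames. In such a frame the metric and the `α_j`
are constant, and being parallel they are annihilated by the connection form `ω`; so `ω_u ∈ 𝔤_x`.
The tangent planes become a family of calibrated planes in the fixed space `T_xM`. By transitivity
the family lies in one orbit of `G_x`, so the derivative of its projections is `[Y, π]` with `Y ∈
𝔤_x` (`ActsTransitively.exists_generator`). Therefore `∇̄_u π = [Y + ω_u, π]`. Compliance splits
`𝔤_x` into `𝔥_x` and its off-diagonal part (`IsCompliantAt.exists_offDiagonal`). The `𝔥_x`-part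
commutes with `π` and drops out; the other part is `X`.

That velocities in an orbit come from the Lie algebra is proved by compactness alone. Among the
group elements carrying the initial plane to the plane at time `t`, take one closest to the
identity. Minimality forces its distance to the identity to be `O(t)`, along an ultrafilter
converging to `0` from the right, and a limit of difference quotients is the generator.

For the holonomy, each condition defining `H_x` is expressed as invariance of a `∇̂`-parallel
multilinear form: the metric, the volume form of an adapted frame, the `α_j`, and the metric
restricted to normal components, whose null vectors are the tangent vectors. The notion of
parallelism used in the proof (`IsParallelMultilinearAt`) includes differentiability, so that it can
be pulled back to curves. -/

namespace Calibrated

/-! ### Infinitesimal stabilizers of forms and planes -/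

section LieAlgebra

open Filter Topology NormedSpace

variable {V : Type*} [NormedAddCommGroup V] [InnerProductSpace ℝ V]

/-- The inner product as a continuous multilinear map. -/
noncomputable def innerMultilinear (V : Type*) [NormedAddCommGroup V] [InnerProductSpace ℝ V] :
    ContinuousMultilinearMap ℝ (fun _ : Fin 2 => V) ℝ where
  toFun v := ⟪v 0, v 1⟫_ℝ
  map_update_add' v i x y := by
    fin_cases i <;> simp [inner_add_left, inner_add_right]
  map_update_smul' v i c x := by
    fin_cases i <;> simp [inner_smul_left, inner_smul_right]
  cont := by fun_prop

@[simp] theorem innerMultilinear_apply (v : Fin 2 → V) : innerMultilinear V v = ⟪v 0, v 1⟫_ℝ := rfl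

/-- The infinitesimal action of an endomorphism on a multilinear form. -/
def derivAction {m : ℕ} (X : V →L[ℝ] V) (β : ContinuousMultilinearMap ℝ (fun _ : Fin m => V) ℝ)
    (v : Fin m → V) : ℝ :=
  ∑ i, β (Function.update v i (X (v i)))

theorem derivAction_innerMultilinear (X : V →L[ℝ] V) (v : Fin 2 → V) :
    derivAction X (innerMultilinear V) v = ⟪X (v 0), v 1⟫_ℝ + ⟪v 0, X (v 1)⟫_ℝ := by
  simp [derivAction, Fin.sum_univ_two]

theorem derivAction_add {m : ℕ} (X Y : V →L[ℝ] V)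
    (β : ContinuousMultilinearMap ℝ (fun _ : Fin m => V) ℝ) (v : Fin m → V) :
    derivAction (X + Y) β v = derivAction X β v + derivAction Y β v := by
  simp [derivAction, ContinuousMultilinearMap.map_update_add, Finset.sum_add_distrib]

theorem derivAction_smul {m : ℕ} (c : ℝ) (X : V →L[ℝ] V)
    (β : ContinuousMultilinearMap ℝ (fun _ : Fin m => V) ℝ) (v : Fin m → V) :
    derivAction (c • X) β v = c * derivAction X β v := by
  simp [derivAction, ContinuousMultilinearMap.map_update_smul, Finset.mul_sum]

theorem hasFDerivAt_evalMultilinear {m : ℕ}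
    (β : ContinuousMultilinearMap ℝ (fun _ : Fin m => V) ℝ) (v : Fin m → V) (P : V →L[ℝ] V) :
    HasFDerivAt (fun P : V →L[ℝ] V => β (fun i => P (v i)))
      (∑ i, (β.toContinuousLinearMap (fun j => P (v j)) i) ∘L
        (ContinuousLinearMap.apply ℝ V (v i))) P := by
  have h := (hasFDerivAt_const β P).continuousMultilinearMap_apply
    (g := fun i (P : V →L[ℝ] V) => P (v i))
    (fun i => (ContinuousLinearMap.apply ℝ V (v i)).hasFDerivAt)
  refine h.congr_fderiv ?_
  ext Q
  simp

theorem hasDerivAt_multilinear_exp {m : ℕ}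
    (β : ContinuousMultilinearMap ℝ (fun _ : Fin m => V) ℝ) [CompleteSpace V]
    (X : V →L[ℝ] V) (v : Fin m → V) (t : ℝ) :
    HasDerivAt (fun t : ℝ => β (fun i => exp (t • X) (v i)))
      (derivAction X β (fun i => exp (t • X) (v i))) t := by
  have h := (hasFDerivAt_evalMultilinear β v (exp (t • X))).comp_hasDerivAt t
    (hasDerivAt_exp_smul_const' (𝕂 := ℝ) X t)
  refine h.congr_deriv ?_
  simp [derivAction]

/-- The derivative of `β` along `t ↦ exp (t • X) v` is the infinitesimal action evaluated at the
transported vectors. It therefore vanishes for all `t` once the action vanishes on all tuples;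
conversely, look at `t = 0`. -/
theorem multilinear_exp_invariant_iff {m : ℕ}
    (β : ContinuousMultilinearMap ℝ (fun _ : Fin m => V) ℝ) [CompleteSpace V] (X : V →L[ℝ] V) :
    (∀ (t : ℝ) (v : Fin m → V), β (fun i => exp (t • X) (v i)) = β v) ↔
      ∀ v, derivAction X β v = 0 := by
  constructor
  · intro h v
    have h1 := hasDerivAt_multilinear_exp β X v 0
    have h2 : (fun t : ℝ => β (fun i => exp (t • X) (v i))) = fun _ => β v := by
      funext t; exact h t v
    rw [h2] at h1
    simpa using h1.unique (hasDerivAt_const (0 : ℝ) (β v))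
  · intro h t v
    have h1 : ∀ t, HasDerivAt (fun t : ℝ => β (fun i => exp (t • X) (v i))) 0 t := fun t => by
      simpa [h] using hasDerivAt_multilinear_exp β X v t
    have := is_const_of_deriv_eq_zero (fun t => (h1 t).differentiableAt) (fun t => (h1 t).deriv) t 0
    simpa using this

/-- An endomorphism infinitesimally preserves a multilinear form if it is a limit of difference
quotients of endomorphisms which preserve the form. -/
theorem derivAction_eq_zero_of_tendsto {m : ℕ}
    (β : ContinuousMultilinearMap ℝ (fun _ : Fin m => V) ℝ) {T : Type*} {l : Filter T} [l.NeBot]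
    {P : T → V →L[ℝ] V} {c : T → ℝ} {Y : V →L[ℝ] V}
    (hP : ∀ᶠ t in l, ∀ v : Fin m → V, β (fun i => P t (v i)) = β v)
    (hP1 : Tendsto P l (𝓝 1)) (hY : Tendsto (fun t => c t • (P t - 1)) l (𝓝 Y)) (v : Fin m → V) :
    derivAction Y β v = 0 := by
  have h := (hasFDerivAt_evalMultilinear β v 1).hasFDerivWithinAt (s := Set.univ)
  have h1 := h.lim (l := l) (c := c) (d := fun t => P t - 1) (v := Y)
    (by simpa using hP1.sub_const 1) (by simp) hY
  -- These quotients tend to the derivative of `β` at `1` in the direction `Y`, but they vanish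
  -- eventually because `P t` preserves `β`.
  have h2 : Tendsto (fun t => c t • (β (fun i => (1 + (P t - 1)) (v i)) -
      β (fun i => (1 : V →L[ℝ] V) (v i)))) l (𝓝 0) := by
    refine tendsto_const_nhds.congr' ?_
    filter_upwards [hP] with t ht
    simp [ht]
  have h3 := tendsto_nhds_unique h1 h2
  simpa [derivAction] using h3

variable {N : ℕ} {deg : Fin (N + 1) → ℕ}

theorem diamond_eq_derivAction {m : ℕ} (X : V →L[ℝ] V) (β : V [⋀^Fin m]→L[ℝ] ℝ) :
    diamond X β = derivAction X β.toContinuousMultilinearMap := rfl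

/-- The infinitesimal stabilizer of the forms `a j` in the skew endomorphisms. -/
def infStab (a : ∀ j, V [⋀^Fin (deg j)]→L[ℝ] ℝ) : Submodule ℝ (V →L[ℝ] V) where
  carrier := {X | (∀ v, derivAction X (innerMultilinear V) v = 0) ∧
    ∀ j v, derivAction X (a j).toContinuousMultilinearMap v = 0}
  add_mem' hX hY := by
    refine ⟨fun v => ?_, fun j v => ?_⟩
    · simp [derivAction_add, hX.1, hY.1]
    · simp [derivAction_add, hX.2, hY.2]
  zero_mem' := by
    refine ⟨fun v => ?_, fun j v => ?_⟩
    · simp [derivAction_innerMultilinear]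
    · have := derivAction_smul (0 : ℝ) 0 (a j).toContinuousMultilinearMap v
      simpa using this
  smul_mem' c X hX := by
    refine ⟨fun v => ?_, fun j v => ?_⟩
    · simp [derivAction_smul, hX.1]
    · simp [derivAction_smul, hX.2]

theorem infStab_skew {a : ∀ j, V [⋀^Fin (deg j)]→L[ℝ] ℝ} {X : V →L[ℝ] V} (hX : X ∈ infStab a)
    (v w : V) : ⟪X v, w⟫_ℝ = - ⟪v, X w⟫_ℝ := by
  have := hX.1 ![v, w]
  rw [derivAction_innerMultilinear] at this
  simp at this
  linarith

variable [FiniteDimensional ℝ V]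

theorem det_eq_one_or_neg_one {P : V →L[ℝ] V} (hP : ∀ v w, ⟪P v, P w⟫_ℝ = ⟪v, w⟫_ℝ) :
    P.det = 1 ∨ P.det = -1 := by
  have h1 : ContinuousLinearMap.adjoint P * P = 1 := by
    ext v
    refine ext_inner_right ℝ fun w => ?_
    simp [ContinuousLinearMap.adjoint_inner_left, hP]
  have h2 : LinearMap.det ((ContinuousLinearMap.adjoint P : V →L[ℝ] V) : V →ₗ[ℝ] V) *
      LinearMap.det (P : V →ₗ[ℝ] V) = 1 := by
    rw [← LinearMap.det_comp]
    have : ((ContinuousLinearMap.adjoint P : V →L[ℝ] V) : V →ₗ[ℝ] V) ∘ₗ (P : V →ₗ[ℝ] V) =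
      LinearMap.id := by
      ext v; exact congrArg (fun A : V →L[ℝ] V => A v) h1
    rw [this, LinearMap.det_id]
  have h3 : LinearMap.det ((ContinuousLinearMap.adjoint P : V →L[ℝ] V) : V →ₗ[ℝ] V) =
      LinearMap.det (P : V →ₗ[ℝ] V) := by
    change LinearMap.det (LinearMap.adjoint (P : V →ₗ[ℝ] V)) = _
    rw [← LinearMap.det_toMatrix (stdOrthonormalBasis ℝ V).toBasis, LinearMap.toMatrix_adjoint,
      Matrix.det_conjTranspose, LinearMap.det_toMatrix]
    simp
  rw [h3] at h2
  exact mul_self_eq_one_iff.mp h2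

theorem exp_smul_mem_of_mem_infStab {a : ∀ j, V [⋀^Fin (deg j)]→L[ℝ] ℝ} {X : V →L[ℝ] V}
    (hX : X ∈ infStab a) (t : ℝ) : exp (t • X) ∈ stabGroup a := by
  have h1 : ∀ (t : ℝ) (v w : V), ⟪exp (t • X) v, exp (t • X) w⟫_ℝ = ⟪v, w⟫_ℝ := fun t v w => by
    have := (multilinear_exp_invariant_iff (innerMultilinear V) X).2 hX.1 t ![v, w]
    simpa using this
  refine ⟨h1 t, ?_, fun j v =>
    (multilinear_exp_invariant_iff (a j).toContinuousMultilinearMap X).2 (hX.2 j) t v⟩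
  -- An isometry has determinant `±1`, and `exp (t • X)` is the square of one; so its determinant is
  -- `1`.
  have h2 : exp (t • X) = exp ((t / 2) • X) * exp ((t / 2) • X) := by
    let _ : NormedAlgebra ℚ (V →L[ℝ] V) := .restrictScalars ℚ ℝ _
    rw [← exp_add_of_commute (Commute.refl _), ← add_smul]
    congr 2
    ring
  have h3 : (exp (t • X)).det = (exp ((t / 2) • X)).det * (exp ((t / 2) • X)).det := by
    rw [h2]
    exact LinearMap.det_comp _ _
  rcases det_eq_one_or_neg_one (h1 (t / 2)) with h | h <;> rw [h3, h] <;> norm_num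

/-- Replaces the one-parameter-group definition by linear conditions, so that the Lie algebra is
visibly a subspace. -/
theorem mem_lieAlg_stabGroup_iff {a : ∀ j, V [⋀^Fin (deg j)]→L[ℝ] ℝ} {X : V →L[ℝ] V} :
    X ∈ lieAlg (stabGroup a) ↔ X ∈ infStab a := by
  refine ⟨fun h => ⟨?_, fun j => ?_⟩, fun h t => exp_smul_mem_of_mem_infStab h t⟩
  · exact (multilinear_exp_invariant_iff (innerMultilinear V) X).1 fun t v => (h t).1 (v 0) (v 1)
  · exact (multilinear_exp_invariant_iff (a j).toContinuousMultilinearMap X).1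
      fun t v => (h t).2.2 j v

/-- The infinitesimal stabilizer of the plane `W` in that of the forms `a j`. -/
def infStabPlane (a : ∀ j, V [⋀^Fin (deg j)]→L[ℝ] ℝ) (W : Submodule ℝ V) :
    Submodule ℝ (V →L[ℝ] V) where
  carrier := {X | X ∈ infStab a ∧ ∀ v ∈ W, X v ∈ W}
  add_mem' hX hY := ⟨add_mem hX.1 hY.1, fun v hv => add_mem (hX.2 v hv) (hY.2 v hv)⟩
  zero_mem' := ⟨zero_mem _, fun _ _ => zero_mem _⟩
  smul_mem' _ _ hX := ⟨Submodule.smul_mem _ _ hX.1, fun v hv => Submodule.smul_mem _ _ (hX.2 v hv)⟩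

/-- The partial sums of the exponential series keep `v` in `W`, and `W` is closed. -/
theorem exp_mem_of_invariant {W : Submodule ℝ V} {X : V →L[ℝ] V} (h : ∀ v ∈ W, X v ∈ W) {v : V}
    (hv : v ∈ W) : exp X v ∈ W := by
  let _ : NormedAlgebra ℚ (V →L[ℝ] V) := .restrictScalars ℚ ℝ _
  have h1 := (exp_series_hasSum_exp' (𝕂 := ℝ) X).mapL (ContinuousLinearMap.apply ℝ V v)
  refine W.closed_of_finiteDimensional.mem_of_tendsto h1 (Eventually.of_forall fun s => ?_)
  refine W.sum_mem fun n _ => ?_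
  have h2 : ∀ n, (X ^ n) v ∈ W := fun n => by
    induction n with
    | zero => simpa using hv
    | succ n ih => rw [pow_succ']; exact h _ ih
  exact W.smul_mem _ (h2 n)

theorem injective_of_inner {P : V →L[ℝ] V} (hP : ∀ v w, ⟪P v, P w⟫_ℝ = ⟪v, w⟫_ℝ) :
    Function.Injective (P : V →ₗ[ℝ] V) := by
  intro v w hvw
  have h : P (v - w) = 0 := by simpa [sub_eq_zero] using hvw
  have h' := hP (v - w) (v - w)
  rw [h, inner_zero_left] at h'
  exact sub_eq_zero.1 (inner_self_eq_zero.1 h'.symm)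

theorem map_eq_of_mapsTo {W : Submodule ℝ V} {P : V →L[ℝ] V} (hP : ∀ v w, ⟪P v, P w⟫_ℝ = ⟪v, w⟫_ℝ)
    (h : ∀ v ∈ W, P v ∈ W) : W.map (P : V →ₗ[ℝ] V) = W :=
  Submodule.eq_of_le_of_finrank_eq (Submodule.map_le_iff_le_comap.2 h)
    (Submodule.equivMapOfInjective _ (injective_of_inner hP) W).finrank_eq.symm

theorem mem_lieAlg_stabPlane_iff {a : ∀ j, V [⋀^Fin (deg j)]→L[ℝ] ℝ} {W : Submodule ℝ V}
    {X : V →L[ℝ] V} : X ∈ lieAlg (stabPlane a W) ↔ X ∈ infStabPlane a W := by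
  constructor
  · intro h
    refine ⟨mem_lieAlg_stabGroup_iff.1 fun t => (h t).1, fun v hv => ?_⟩
    -- `X v` is the limit of the difference quotients of `exp (t • X) v`, which lie in the closed
    -- subspace `W`.
    have h1 := ((ContinuousLinearMap.apply ℝ V v).hasFDerivAt.comp_hasDerivAt (0 : ℝ)
      (hasDerivAt_exp_smul_const (𝕂 := ℝ) X 0)).tendsto_slope_zero
    simp only [zero_smul, exp_zero, one_mul, ContinuousLinearMap.apply_apply] at h1
    refine W.closed_of_finiteDimensional.mem_of_tendsto h1 (Eventually.of_forall fun t => ?_)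
    refine W.smul_mem _ (W.sub_mem ?_ ?_)
    · have := (h (0 + t)).2
      simp only [Function.comp_apply, ContinuousLinearMap.apply_apply]
      rw [← this]
      exact Submodule.mem_map_of_mem hv
    · simpa using hv
  · intro h t
    have h1 := exp_smul_mem_of_mem_infStab h.1 t
    exact ⟨h1, map_eq_of_mapsTo h1.1 fun v hv =>
      exp_mem_of_invariant (fun w hw => W.smul_mem _ (h.2 w hw)) hv⟩

end LieAlgebra

end Calibrated

namespace Calibrated

/-! ### Compliance: conjugation invariance and the splitting of the Lie algebra -/

section Compliance

open Filter Topology NormedSpace ContinuousLinearMap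

variable {V : Type*} [NormedAddCommGroup V] [InnerProductSpace ℝ V] [FiniteDimensional ℝ V]
variable {N : ℕ} {deg : Fin (N + 1) → ℕ} {a : ∀ j, V [⋀^Fin (deg j)]→L[ℝ] ℝ}

theorem adjoint_mul_self {P : V →L[ℝ] V} (hP : ∀ v w, ⟪P v, P w⟫_ℝ = ⟪v, w⟫_ℝ) :
    adjoint P * P = 1 := by
  ext v
  refine ext_inner_right ℝ fun w => ?_
  simp [adjoint_inner_left, hP]

theorem self_mul_adjoint {P : V →L[ℝ] V} (hP : ∀ v w, ⟪P v, P w⟫_ℝ = ⟪v, w⟫_ℝ) :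
    P * adjoint P = 1 := by
  have h1 : (adjoint P : V →ₗ[ℝ] V) ∘ₗ (P : V →ₗ[ℝ] V) = LinearMap.id := by
    ext v; exact congrArg (fun A : V →L[ℝ] V => A v) (adjoint_mul_self hP)
  have h2 := (LinearMap.comp_eq_id_comm ℝ V).1 h1
  ext v
  exact congrArg (fun A : V →ₗ[ℝ] V => A v) h2

theorem stabGroup_mul {P Q : V →L[ℝ] V} (hP : P ∈ stabGroup a) (hQ : Q ∈ stabGroup a) :
    P * Q ∈ stabGroup a := by
  refine ⟨fun v w => ?_, ?_, fun j v => ?_⟩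
  · simp [hP.1, hQ.1]
  · have : (P * Q).det = P.det * Q.det := LinearMap.det_comp _ _
    rw [this, hP.2.1, hQ.2.1, one_mul]
  · have := hP.2.2 j (fun i => Q (v i))
    simpa [hQ.2.2 j v] using this

theorem stabGroup_adjoint {P : V →L[ℝ] V} (hP : P ∈ stabGroup a) : adjoint P ∈ stabGroup a := by
  have h1 : ∀ v, P (adjoint P v) = v := fun v =>
    congrArg (fun A : V →L[ℝ] V => A v) (self_mul_adjoint hP.1)
  refine ⟨fun v w => ?_, ?_, fun j v => ?_⟩
  · rw [← hP.1, h1, h1]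
  · have h2 : (P * adjoint P).det = P.det * (adjoint P).det := LinearMap.det_comp _ _
    rw [self_mul_adjoint hP.1, hP.2.1, one_mul] at h2
    rw [← h2]
    exact LinearMap.det_id
  · rw [← hP.2.2 j]
    simp [h1]

/-- An element of the stabilizer as a unit of the endomorphism algebra. -/
noncomputable def stabUnit {P : V →L[ℝ] V} (hP : P ∈ stabGroup a) : (V →L[ℝ] V)ˣ :=
  ⟨P, adjoint P, self_mul_adjoint hP.1, adjoint_mul_self hP.1⟩

theorem exp_conj {P : V →L[ℝ] V} (hP : P ∈ stabGroup a) (X : V →L[ℝ] V) (t : ℝ) :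
    exp (t • (P * X * adjoint P)) = P * exp (t • X) * adjoint P := by
  let _ : NormedAlgebra ℚ (V →L[ℝ] V) := .restrictScalars ℚ ℝ _
  have h : exp (P * (t • X) * adjoint P) = P * exp (t • X) * adjoint P :=
    exp_units_conj (stabUnit hP) (t • X)
  rw [← h, mul_smul_comm, smul_mul_assoc]

theorem lieAlg_stabGroup_conj {P X : V →L[ℝ] V} (hP : P ∈ stabGroup a)
    (hX : X ∈ lieAlg (stabGroup a)) : P * X * adjoint P ∈ lieAlg (stabGroup a) := fun t => by
  rw [exp_conj hP]
  exact stabGroup_mul (stabGroup_mul hP (hX t)) (stabGroup_adjoint hP)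

theorem lieAlg_stabPlane_conj {P X : V →L[ℝ] V} {W W' : Submodule ℝ V} (hP : P ∈ stabGroup a)
    (hW : W.map (P : V →ₗ[ℝ] V) = W') (hX : X ∈ lieAlg (stabPlane a W)) :
    P * X * adjoint P ∈ lieAlg (stabPlane a W') := fun t => by
  rw [exp_conj hP]
  refine ⟨stabGroup_mul (stabGroup_mul hP (hX t).1) (stabGroup_adjoint hP), ?_⟩
  have h1 : W'.map (adjoint P : V →ₗ[ℝ] V) = W := by
    rw [← hW, ← Submodule.map_comp]
    have h1 : (adjoint P : V →ₗ[ℝ] V) ∘ₗ (P : V →ₗ[ℝ] V) = LinearMap.id := by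
      ext v; exact congrArg (fun A : V →L[ℝ] V => A v) (adjoint_mul_self hP.1)
    rw [h1, Submodule.map_id]
  have h2 : ((P * exp (t • X) * adjoint P : V →L[ℝ] V) : V →ₗ[ℝ] V) =
    (P : V →ₗ[ℝ] V) ∘ₗ ((exp (t • X) : V →L[ℝ] V) : V →ₗ[ℝ] V) ∘ₗ (adjoint P : V →ₗ[ℝ] V) := rfl
  rw [h2, Submodule.map_comp, Submodule.map_comp, h1, (hX t).2, hW]

/-- In this basis-free form, invariance under conjugation is cyclicity of the trace. -/
theorem endInner_eq_trace (X Y : V →L[ℝ] V) :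
    endInner X Y = LinearMap.trace ℝ V ((adjoint X * Y : V →L[ℝ] V) : V →ₗ[ℝ] V) := by
  rw [LinearMap.trace_eq_sum_inner _ (stdOrthonormalBasis ℝ V)]
  simp [endInner, adjoint_inner_right]

theorem endInner_conj {P : V →L[ℝ] V} (hP : P ∈ stabGroup a) (X Y : V →L[ℝ] V) :
    endInner (P * X * adjoint P) (P * Y * adjoint P) = endInner X Y := by
  rw [endInner_eq_trace, endInner_eq_trace]
  have h : adjoint (P * X * adjoint P) * (P * Y * adjoint P) = P * (adjoint X * Y * adjoint P) := by
    have h1 : adjoint (P * X * adjoint P) = P * adjoint X * adjoint P := by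
      simp only [mul_def, adjoint_comp, adjoint_adjoint, comp_assoc]
    rw [h1]
    calc P * adjoint X * adjoint P * (P * Y * adjoint P) =
        P * adjoint X * (adjoint P * P) * Y * adjoint P := by simp only [mul_assoc]
      _ = _ := by rw [adjoint_mul_self hP.1]; simp only [mul_assoc, one_mul]
  rw [h]
  have h2 := LinearMap.trace_mul_comm ℝ (P : V →ₗ[ℝ] V)
    ((adjoint X * Y * adjoint P : V →L[ℝ] V) : V →ₗ[ℝ] V)
  refine h2.trans (congrArg _ ?_)
  have : adjoint X * Y * adjoint P * P = adjoint X * Y := by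
    rw [mul_assoc, adjoint_mul_self hP.1, mul_one]
  exact congrArg (fun A : V →L[ℝ] V => (A : V →ₗ[ℝ] V)) this

theorem offDiagonal_conj {P X : V →L[ℝ] V} {W W' : Submodule ℝ V} (hP : P ∈ stabGroup a)
    (hW : W.map (P : V →ₗ[ℝ] V) = W') (hX : X ∈ offDiagonal W) :
    P * X * adjoint P ∈ offDiagonal W' := by
  have h1 : ∀ v, P (adjoint P v) = v := fun v =>
    congrArg (fun A : V →L[ℝ] V => A v) (self_mul_adjoint hP.1)
  have h2 : ∀ v, adjoint P (P v) = v := fun v =>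
    congrArg (fun A : V →L[ℝ] V => A v) (adjoint_mul_self hP.1)
  have h3 : ∀ v ∈ Wᗮ, P v ∈ W'ᗮ := fun v hv => by
    rw [← hW, Submodule.mem_orthogonal]
    rintro _ ⟨w, hw, rfl⟩
    exact (hP.1 w v).trans (hv w hw)
  have h4 : ∀ v ∈ W', adjoint P v ∈ W := fun v hv => by
    rw [← hW] at hv
    obtain ⟨w, hw, rfl⟩ := hv
    simpa [h2] using hw
  have h5 : ∀ v ∈ W'ᗮ, adjoint P v ∈ Wᗮ := fun v hv => by
    rw [Submodule.mem_orthogonal]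
    intro w hw
    rw [adjoint_inner_right]
    exact hv _ (hW ▸ Submodule.mem_map_of_mem hw)
  refine ⟨fun v w => ?_, fun v hv => h3 _ (hX.2.1 _ (h4 v hv)), fun v hv => ?_⟩
  · have := hX.1 (adjoint P v) (adjoint P w)
    rw [adjoint_inner_right, adjoint_inner_left] at this
    simpa using this
  · rw [← hW]
    exact Submodule.mem_map_of_mem (hX.2.2 _ (h5 v hv))

/-- Project `X` orthogonally to the stabilizer algebra of `W`. The difference from the projection is
still in `𝔤` and orthogonal to `𝔥`, hence off-diagonal by compliance. -/
theorem IsCompliantAt.exists_offDiagonal {W : Submodule ℝ V} (h : IsCompliantAt a W)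
    {X : V →L[ℝ] V} (hX : X ∈ infStab a) :
    ∃ Y ∈ infStab a, Y ∈ offDiagonal W ∧ X - Y ∈ infStabPlane a W := by
  let B : LinearMap.BilinForm ℝ (V →L[ℝ] V) := LinearMap.mk₂ ℝ endInner
    (by intros; simp [endInner, inner_add_left, Finset.sum_add_distrib])
    (by intros; simp [endInner, inner_smul_left, Finset.mul_sum])
    (by intros; simp [endInner, inner_add_right, Finset.sum_add_distrib])
    (by intros; simp [endInner, inner_smul_right, Finset.mul_sum])
  have hBs : ∀ X Y, B X Y = B Y X := fun X Y => by
    change endInner X Y = endInner Y X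
    exact Finset.sum_congr rfl fun i _ => real_inner_comm _ _
  have hB0 : ∀ X, B X X = 0 → X = 0 := fun X hX => by
    change endInner X X = 0 at hX
    have h1 := (Finset.sum_eq_zero_iff_of_nonneg (fun i _ => real_inner_self_nonneg)).1 hX
    ext v
    have : (X : V →ₗ[ℝ] V) = 0 := (stdOrthonormalBasis ℝ V).toBasis.ext fun i => by
      simpa using h1 i (Finset.mem_univ i)
    exact congrArg (fun A : V →ₗ[ℝ] V => A v) this
  -- Positive definiteness makes the restriction to any subspace nondegenerate.
  have hc := LinearMap.BilinForm.isCompl_orthogonal_of_restrict_nondegenerate (B := B)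
    (W := infStabPlane a W) (fun X Y hXY => (hBs Y X).trans hXY) (by
      constructor
      · intro X hX
        exact Subtype.ext (hB0 _ (hX X))
      · intro X hX
        exact Subtype.ext (hB0 _ (hX X)))
  obtain ⟨Z, hZ, Y, hY, rfl⟩ := Submodule.mem_sup.1 (hc.sup_eq_top ▸ Submodule.mem_top (x := X))
  have hY1 : Y ∈ infStab a := by
    have := sub_mem hX hZ.1
    simpa using this
  have hY2 : Y ∈ lieAlg (stabGroup a) ∩ offDiagonal W := by
    rw [← h]
    refine ⟨mem_lieAlg_stabGroup_iff.2 hY1, fun T hT => ?_⟩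
    exact (hBs Y T).trans (hY T (mem_lieAlg_stabPlane_iff.1 hT))
  exact ⟨Y, hY1, hY2.2, by simpa using hZ⟩

/-- An element of `G` carrying the given plane `W₀` to `W` conjugates every ingredient of the
compliance identity for `W₀` to that for `W`. -/
theorem IsCompliant.isCompliantAt (h : IsCompliant a) {W : Submodule ℝ V}
    (hW : IsCalibratedPlane (a 0) W) : IsCompliantAt a W := by
  obtain ⟨W₀, hW₀, hc⟩ := h.compliant
  obtain ⟨P, hP, hPW⟩ := h.transitive W₀ W hW₀ hW
  have hP' := stabGroup_adjoint hP
  have hPW' : W.map (adjoint P : V →ₗ[ℝ] V) = W₀ := by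
    rw [← hPW, ← Submodule.map_comp]
    have h1 : (adjoint P : V →ₗ[ℝ] V) ∘ₗ (P : V →ₗ[ℝ] V) = LinearMap.id := by
      ext v; exact congrArg (fun A : V →L[ℝ] V => A v) (adjoint_mul_self hP.1)
    rw [h1, Submodule.map_id]
  have hcc : ∀ X : V →L[ℝ] V, P * (adjoint P * X * adjoint (adjoint P)) * adjoint P = X := fun X => by
    rw [adjoint_adjoint]
    calc _ = (P * adjoint P) * X * (P * adjoint P) := by simp only [mul_assoc]
      _ = X := by rw [self_mul_adjoint hP.1, one_mul, mul_one]
  have hiff : ∀ X, (∀ Y ∈ lieAlg (stabPlane a W), endInner X Y = 0) ↔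
      ∀ Y ∈ lieAlg (stabPlane a W₀), endInner (adjoint P * X * adjoint (adjoint P)) Y = 0 := by
    refine fun X => ⟨fun hX Y hY => ?_, fun hX Y hY => ?_⟩
    · rw [← endInner_conj hP, hcc]
      exact hX _ (lieAlg_stabPlane_conj hP hPW hY)
    · rw [← endInner_conj hP']
      exact hX _ (lieAlg_stabPlane_conj hP' hPW' hY)
  ext X
  have hX := Set.ext_iff.1 hc (adjoint P * X * adjoint (adjoint P))
  constructor
  · rintro ⟨h1, h2⟩
    have := hX.1 ⟨lieAlg_stabGroup_conj hP' h1, (hiff X).1 h2⟩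
    exact ⟨h1, hcc X ▸ offDiagonal_conj hP hPW this.2⟩
  · rintro ⟨h1, h2⟩
    exact ⟨h1, (hiff X).2
      (hX.2 ⟨lieAlg_stabGroup_conj hP' h1, offDiagonal_conj hP' hPW' h2⟩).2⟩

end Compliance

end Calibrated

namespace Calibrated

/-! ### Velocities of curves of calibrated planes -/

section OrbitTangent

open Filter Topology NormedSpace ContinuousLinearMap

variable {V : Type*} [NormedAddCommGroup V] [InnerProductSpace ℝ V] [FiniteDimensional ℝ V]
variable {N : ℕ} {deg : Fin (N + 1) → ℕ} {a : ∀ j, V [⋀^Fin (deg j)]→L[ℝ] ℝ}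

theorem isCompact_stabGroup : IsCompact (stabGroup a) := by
  refine (ProperSpace.isCompact_closedBall (0 : V →L[ℝ] V) 1).of_isClosed_subset ?_ ?_
  · have h : stabGroup a = (⋂ v, ⋂ w, {P : V →L[ℝ] V | ⟪P v, P w⟫_ℝ = ⟪v, w⟫_ℝ}) ∩
        ({P | P.det = 1} ∩ ⋂ j, ⋂ v, {P : V →L[ℝ] V | a j (fun i => P (v i)) = a j v}) := by
      ext P; simp [stabGroup]
    rw [h]
    refine (isClosed_iInter fun v => isClosed_iInter fun w => ?_).inter
      (IsClosed.inter ?_ (isClosed_iInter fun j => isClosed_iInter fun v => ?_))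
    · exact isClosed_eq (by fun_prop) continuous_const
    · exact isClosed_eq ContinuousLinearMap.continuous_det continuous_const
    · exact isClosed_eq ((a j).cont.comp (by fun_prop)) continuous_const
  · intro P hP
    rw [mem_closedBall_zero_iff]
    refine P.opNorm_le_bound zero_le_one fun v => ?_
    have : ‖P v‖ ^ 2 = ‖v‖ ^ 2 := by
      rw [← real_inner_self_eq_norm_sq, ← real_inner_self_eq_norm_sq, hP.1]
    rw [one_mul]
    exact (pow_le_pow_iff_left₀ (norm_nonneg _) (norm_nonneg _) two_ne_zero).1 this.le

/-- Encodes "`P` carries `W` to `W'`" as an equation between operators, which survives limits and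
can be differentiated. -/
theorem mul_starProjection_eq {P : V →L[ℝ] V} (hP : P ∈ stabGroup a) {W W' : Submodule ℝ V}
    (hW : W.map (P : V →ₗ[ℝ] V) = W') : P * W.starProjection = W'.starProjection * P := by
  ext v
  refine (Submodule.eq_starProjection_of_mem_of_inner_eq_zero ?_ ?_).symm
  · rw [← hW]
    exact Submodule.mem_map_of_mem (W.starProjection_apply_mem v)
  · rw [← hW]
    rintro _ ⟨w, hw, rfl⟩
    change ⟪P v - P (W.starProjection v), P w⟫_ℝ = 0
    rw [← map_sub, hP.1]
    exact Submodule.starProjection_inner_eq_zero v w hw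

theorem mem_infStab_of_tendsto {T : Type*} {l : Filter T} [l.NeBot]
    {P : T → V →L[ℝ] V} {c : T → ℝ} {Y : V →L[ℝ] V} (hP : ∀ᶠ t in l, P t ∈ stabGroup a)
    (hP1 : Tendsto P l (𝓝 1)) (hY : Tendsto (fun t => c t • (P t - 1)) l (𝓝 Y)) :
    Y ∈ infStab a := by
  refine ⟨derivAction_eq_zero_of_tendsto _ ?_ hP1 hY,
    fun j => derivAction_eq_zero_of_tendsto _ ?_ hP1 hY⟩
  · filter_upwards [hP] with t ht v using ht.1 _ _
  · filter_upwards [hP] with t ht v using ht.2.2 j v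

/-- The velocity of a curve in the orbit of `W 0` under the stabilizer of the forms `a j` is tangent
to this orbit: it is generated by an element of the Lie algebra. -/
theorem ActsTransitively.exists_generator (ha : ActsTransitively a) {W : ℝ → Submodule ℝ V}
    (hW : ∀ᶠ t in 𝓝 0, IsCalibratedPlane (a 0) (W t)) {c' : V →L[ℝ] V}
    (hc : HasDerivAt (fun t => (W t).starProjection) c' 0) :
    ∃ X ∈ infStab a, c' = X * (W 0).starProjection - (W 0).starProjection * X := by
  set c : ℝ → V →L[ℝ] V := fun t => (W t).starProjection with hcdef
  -- Along an ultrafilter, every family with values in a compact set converges, so no subsequences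
  -- are needed.
  let 𝒰 : Ultrafilter ℝ := Ultrafilter.of (𝓝[>] 0)
  have h𝒰 : (𝒰 : Filter ℝ) ≤ 𝓝[>] 0 := Ultrafilter.of_le _
  have h𝒰0 : (𝒰 : Filter ℝ) ≤ 𝓝 0 := h𝒰.trans nhdsWithin_le_nhds
  have hpos : ∀ᶠ t in (𝒰 : Filter ℝ), 0 < t := h𝒰 self_mem_nhdsWithin
  have hW0 : IsCalibratedPlane (a 0) (W 0) := hW.self_of_nhds
  -- `P t` is an element of `G` carrying `W 0` to `W t` at minimal distance from `1`; it exists by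
  -- compactness. Where `W t` is not calibrated, the value is irrelevant.
  have hP : ∀ t, ∃ P, IsCalibratedPlane (a 0) (W t) →
      P ∈ stabGroup a ∧ P * c 0 = c t * P ∧
        ∀ Q ∈ stabGroup a, Q * c 0 = c t * Q → ‖P - 1‖ ≤ ‖Q - 1‖ := by
    intro t
    by_cases ht : IsCalibratedPlane (a 0) (W t)
    · obtain ⟨P₀, hP₀, hP₀W⟩ := ha _ _ hW0 ht
      have hcomp : IsCompact (stabGroup a ∩ {P | P * c 0 = c t * P}) :=
        isCompact_stabGroup.inter_right (isClosed_eq (by fun_prop) (by fun_prop))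
      obtain ⟨P, hP, hmin⟩ := hcomp.exists_isMinOn ⟨P₀, hP₀, mul_starProjection_eq hP₀ hP₀W⟩
        (f := fun P => ‖P - 1‖) (by fun_prop)
      exact ⟨P, fun _ => ⟨hP.1, hP.2, fun Q hQ hQ' => hmin ⟨hQ, hQ'⟩⟩⟩
    · exact ⟨0, fun h => absurd h ht⟩
  choose P hP using hP
  have hP' : ∀ᶠ t in (𝒰 : Filter ℝ), P t ∈ stabGroup a ∧ P t * c 0 = c t * P t ∧
      ∀ Q ∈ stabGroup a, Q * c 0 = c t * Q → ‖P t - 1‖ ≤ ‖Q - 1‖ := by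
    filter_upwards [h𝒰0 hW] with t ht using hP t ht
  -- If `Q` stabilizes `W 0`, then `P t * Q` is a competitor of `P t`.
  have hmin : ∀ᶠ t in (𝒰 : Filter ℝ), ∀ Q ∈ stabGroup a, Q * c 0 = c 0 * Q →
      ‖P t - 1‖ ≤ ‖P t * Q - 1‖ := by
    filter_upwards [hP'] with t ht Q hQ hQ'
    refine ht.2.2 _ (stabGroup_mul ht.1 hQ) ?_
    rw [mul_assoc, hQ', ← mul_assoc, ht.2.1, mul_assoc]
  have hct : Tendsto c 𝒰 (𝓝 (c 0)) := hc.continuousAt.tendsto.mono_left h𝒰0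
  have hslope : Tendsto (fun t => t⁻¹ • (c t - c 0)) 𝒰 (𝓝 c') := by
    have := hasDerivAt_iff_tendsto_slope_zero.1 hc
    simp only [zero_add] at this
    exact this.mono_left (h𝒰.trans (nhdsWithin_mono _ fun t ht => ne_of_gt ht))
  -- Any limit `R` of `P` stabilizes `W 0`. Hence `P t * adjoint R` is a competitor tending to `1`,
  -- and the minimizer `P t` is at least as close.
  have hP1 : Tendsto P 𝒰 (𝓝 1) := by
    obtain ⟨R, hR, hPR⟩ := isCompact_stabGroup.ultrafilter_le_nhds' (𝒰.map P)
      (hP'.mono fun t ht => ht.1)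
    have hPR : Tendsto P 𝒰 (𝓝 R) := hPR
    have hRc : R * c 0 = c 0 * R := by
      refine tendsto_nhds_unique (hPR.mul_const (c 0)) ((hct.mul hPR).congr' ?_)
      filter_upwards [hP'] with t ht using ht.2.1.symm
    have hRc' : adjoint R * c 0 = c 0 * adjoint R := by
      calc adjoint R * c 0 = adjoint R * (c 0 * R) * adjoint R := by
            rw [mul_assoc, mul_assoc, self_mul_adjoint hR.1, mul_one]
        _ = c 0 * adjoint R := by
            rw [← hRc, ← mul_assoc, adjoint_mul_self hR.1, one_mul]
    have h1 : Tendsto (fun t => ‖P t * adjoint R - 1‖) 𝒰 (𝓝 0) := by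
      have := ((hPR.mul_const (adjoint R)).sub_const 1).norm
      rwa [self_mul_adjoint hR.1, sub_self, norm_zero] at this
    rw [tendsto_iff_norm_sub_tendsto_zero]
    refine squeeze_zero' (Eventually.of_forall fun t => norm_nonneg _) ?_ h1
    filter_upwards [hmin] with t ht using ht _ (stabGroup_adjoint hR) hRc'
  -- This is `P t * c 0 = c t * P t`, rearranged and scaled by `k t`. It is used with `k = t⁻¹` and
  -- with `k = ‖P t - 1‖⁻¹`.
  have hcomm : ∀ (k : ℝ → ℝ), ∀ᶠ t in (𝒰 : Filter ℝ), (k t * t) • (t⁻¹ • (c t - c 0)) * P t =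
      (k t • (P t - 1)) * c 0 - c 0 * (k t • (P t - 1)) := fun k => by
    filter_upwards [hP', hpos] with t ht ht0
    rw [smul_smul, mul_assoc, mul_inv_cancel₀ ht0.ne', mul_one, smul_mul_assoc, smul_mul_assoc,
      mul_smul_comm, ← smul_sub, sub_mul, ← ht.2.1, sub_mul, mul_sub, one_mul, mul_one]
    congr 1
    abel
  have hStab : ∀ᶠ t in (𝒰 : Filter ℝ), P t ∈ stabGroup a := hP'.mono fun t ht => ht.1
  -- If the distance is `O(t)`, the limit of `t⁻¹ • (P t - 1)` is the generator. Otherwise the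
  -- distance dominates `t`, which will contradict minimality.
  by_cases hA : ∃ C : ℝ, ∀ᶠ t in (𝒰 : Filter ℝ), ‖P t - 1‖ ≤ C * t
  · obtain ⟨C, hC⟩ := hA
    obtain ⟨Y, -, hY⟩ := (ProperSpace.isCompact_closedBall (0 : V →L[ℝ] V) C).ultrafilter_le_nhds'
      (𝒰.map fun t => t⁻¹ • (P t - 1)) (by
        change ∀ᶠ t in (𝒰 : Filter ℝ), t⁻¹ • (P t - 1) ∈ Metric.closedBall 0 C
        filter_upwards [hC, hpos] with t ht ht0
        rw [mem_closedBall_zero_iff, norm_smul, norm_inv, Real.norm_of_nonneg ht0.le,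
          inv_mul_le_iff₀ ht0, mul_comm]
        exact ht)
    have hY : Tendsto (fun t => t⁻¹ • (P t - 1)) 𝒰 (𝓝 Y) := hY
    refine ⟨Y, mem_infStab_of_tendsto hStab hP1 hY, ?_⟩
    have h1 : Tendsto (fun t => (t⁻¹ * t) • (t⁻¹ • (c t - c 0)) * P t) 𝒰 (𝓝 (c' * 1)) := by
      refine (hslope.mul hP1).congr' ?_
      filter_upwards [hpos] with t ht0
      rw [inv_mul_cancel₀ ht0.ne', one_smul]
    have h2 := h1.congr' (hcomm fun t => t⁻¹)
    have h3 := tendsto_nhds_unique h2 ((hY.mul_const (c 0)).sub (hY.const_mul (c 0)))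
    rwa [mul_one] at h3
  · exfalso
    have hB : ∀ C : ℝ, ∀ᶠ t in (𝒰 : Filter ℝ), C * t < ‖P t - 1‖ := fun C => by
      have h1 : ¬ ∀ᶠ t in (𝒰 : Filter ℝ), ‖P t - 1‖ ≤ C * t := fun h => hA ⟨C, h⟩
      have h2 := Ultrafilter.eventually_not.2 h1
      filter_upwards [h2] with t ht using not_le.1 ht
    set ε : ℝ → ℝ := fun t => ‖P t - 1‖ with hε
    have hεpos : ∀ᶠ t in (𝒰 : Filter ℝ), 0 < ε t := by
      filter_upwards [hB 0] with t ht
      rwa [zero_mul] at ht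
    have hε0 : Tendsto ε 𝒰 (𝓝 0) := by
      have := (hP1.sub_const 1).norm
      simpa using this
    have hratio : Tendsto (fun t => (ε t)⁻¹ * t) 𝒰 (𝓝 0) := by
      rw [Metric.tendsto_nhds]
      intro δ hδ
      filter_upwards [hB δ⁻¹, hεpos, hpos] with t h1 h2 h3
      rw [Real.dist_0_eq_abs, abs_of_pos (by positivity), inv_mul_lt_iff₀ h2]
      rw [inv_mul_lt_iff₀ hδ] at h1
      linarith
    obtain ⟨Y, -, hY⟩ := (ProperSpace.isCompact_closedBall (0 : V →L[ℝ] V) 1).ultrafilter_le_nhds'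
      (𝒰.map fun t => (ε t)⁻¹ • (P t - 1)) (by
        change ∀ᶠ t in (𝒰 : Filter ℝ), (ε t)⁻¹ • (P t - 1) ∈ Metric.closedBall 0 1
        filter_upwards [hεpos] with t ht
        rw [mem_closedBall_zero_iff, norm_smul, norm_inv, Real.norm_of_nonneg ht.le]
        exact (inv_mul_cancel₀ ht.ne').le)
    have hY : Tendsto (fun t => (ε t)⁻¹ • (P t - 1)) 𝒰 (𝓝 Y) := hY
    have hYg := mem_infStab_of_tendsto hStab hP1 hY
    -- Since `t / ε t → 0`, the motion of the plane is negligible at scale `ε`, so the limiting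
    -- direction `Y` stabilizes `W 0`.
    have hYc : Y * c 0 = c 0 * Y := by
      have h1 := ((hratio.smul hslope).mul hP1).congr' (hcomm fun t => (ε t)⁻¹)
      have h3 := tendsto_nhds_unique h1 ((hY.mul_const (c 0)).sub (hY.const_mul (c 0)))
      rw [zero_smul, zero_mul] at h3
      exact (sub_eq_zero.1 h3.symm)
    let _ : NormedAlgebra ℚ (V →L[ℝ] V) := .restrictScalars ℚ ℝ _
    have hexp1 : Tendsto (fun t => exp ((-ε t) • Y)) 𝒰 (𝓝 1) := by
      have h1 : Continuous fun s : ℝ => exp (s • Y) := exp_continuous.comp (by fun_prop)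
      have h2 := (h1.tendsto 0).comp (by simpa using hε0.neg : Tendsto (fun t => -ε t) 𝒰 (𝓝 0))
      simpa [Function.comp_def] using h2
    have hexp2 : Tendsto (fun t => (ε t)⁻¹ • (exp ((-ε t) • Y) - 1)) 𝒰 (𝓝 (-Y)) := by
      have h1 := hasDerivAt_iff_tendsto_slope_zero.1 (hasDerivAt_exp_smul_const (𝕂 := ℝ) Y 0)
      simp only [zero_add, zero_smul, exp_zero, one_mul] at h1
      have h2 : Tendsto (fun t => -ε t) 𝒰 (𝓝[≠] 0) := by
        rw [tendsto_nhdsWithin_iff]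
        refine ⟨by simpa using hε0.neg, ?_⟩
        filter_upwards [hεpos] with t ht
        simpa using ht.ne'
      have h3 := (h1.comp h2).neg
      refine h3.congr fun t => ?_
      simp only [Function.comp_apply]
      rw [inv_neg, neg_smul, neg_neg]
    -- The factor `exp ((-ε t) • Y)` cancels the first-order term of `P t`. As it stabilizes `W 0`,
    -- the product is a competitor at distance `o(ε t)`, whereas the minimal distance is `ε t`.
    have h0 : Tendsto (fun t => (ε t)⁻¹ • (P t * exp ((-ε t) • Y) - 1)) 𝒰 (𝓝 0) := by
      have h1 := (hY.mul hexp1).add hexp2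
      rw [mul_one, add_neg_cancel] at h1
      refine h1.congr fun t => ?_
      rw [smul_mul_assoc, ← smul_add, sub_mul, one_mul]
      congr 1
      abel
    have h1 : ∀ᶠ t in (𝒰 : Filter ℝ), 1 ≤ ‖(ε t)⁻¹ • (P t * exp ((-ε t) • Y) - 1)‖ := by
      filter_upwards [hmin, hεpos] with t ht ht0
      have h2 : Commute (exp ((-ε t) • Y)) (c 0) :=
        Commute.exp_left (Commute.smul_left hYc _)
      have h3 := ht _ (exp_smul_mem_of_mem_infStab hYg _) h2
      rw [norm_smul, norm_inv, Real.norm_of_nonneg ht0.le, le_inv_mul_iff₀ ht0, mul_one]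
      exact h3
    have h2 := ge_of_tendsto h0.norm h1
    rw [norm_zero] at h2
    exact absurd h2 (by norm_num)

/-- For a compliant calibration, the velocity of a curve of calibrated planes is generated by an
element of the Lie algebra which exchanges the plane and its orthogonal complement. -/
theorem IsCompliant.exists_offDiagonal_generator (ha : IsCompliant a) {W : ℝ → Submodule ℝ V}
    (hW : ∀ᶠ t in 𝓝 0, IsCalibratedPlane (a 0) (W t)) {c' : V →L[ℝ] V}
    (hc : HasDerivAt (fun t => (W t).starProjection) c' 0) {Z : V →L[ℝ] V} (hZ : Z ∈ infStab a) :
    ∃ X ∈ infStab a, X ∈ offDiagonal (W 0) ∧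
      c' + (Z * (W 0).starProjection - (W 0).starProjection * Z) =
        X * (W 0).starProjection - (W 0).starProjection * X := by
  -- `Z` will be the connection form in an adapted frame; the sum `Y + Z` is split as a whole.
  obtain ⟨Y, hY, hYc⟩ := ha.transitive.exists_generator hW hc
  obtain ⟨X, hX, hXo, hXd⟩ := (ha.isCompliantAt hW.self_of_nhds).exists_offDiagonal (add_mem hY hZ)
  refine ⟨X, hX, hXo, ?_⟩
  -- A skew endomorphism preserving `W 0` also preserves its complement, hence commutes with the
  -- projection.
  have h : (Y + Z - X) * (W 0).starProjection = (W 0).starProjection * (Y + Z - X) := by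
    ext v
    refine (Submodule.eq_starProjection_of_mem_of_inner_eq_zero ?_ fun w hw => ?_).symm
    · exact hXd.2 _ ((W 0).starProjection_apply_mem v)
    · change ⟪(Y + Z - X) v - (Y + Z - X) ((W 0).starProjection v), w⟫_ℝ = 0
      rw [← map_sub, infStab_skew hXd.1, neg_eq_zero]
      exact Submodule.starProjection_inner_eq_zero v _ (hXd.2 w hw)
  rw [hYc]
  have h' := sub_eq_zero.2 h
  have : Y * (W 0).starProjection - (W 0).starProjection * Y +
      (Z * (W 0).starProjection - (W 0).starProjection * Z) -
      (X * (W 0).starProjection - (W 0).starProjection * X) = 0 := by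
    rw [← h']
    noncomm_ring
  exact sub_eq_zero.1 this

end OrbitTangent

end Calibrated

namespace Calibrated

/-! ### Calculus of vector-valued functions on manifolds -/

section VectorValued

open Filter Topology

variable {E : Type*} [NormedAddCommGroup E] [NormedSpace ℝ E]
  {H : Type*} [TopologicalSpace H] {I : ModelWithCorners ℝ E H}
  {M : Type*} [TopologicalSpace M] [ChartedSpace H M] {x : M}
  {F : Type*} [NormedAddCommGroup F] [NormedSpace ℝ F]
  {G : Type*} [NormedAddCommGroup G] [NormedSpace ℝ G]

/-- `φ' = dφ_x`, for a function `φ` with values in a normed space. -/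
def HasMVFDerivAt (I : ModelWithCorners ℝ E H) (φ : M → F) (x : M)
    (φ' : TangentSpace I x →L[ℝ] F) : Prop :=
  HasMFDerivAt I 𝓘(ℝ, F) φ x φ'

/-- The product and composition rules below are transferred from normed spaces through this
unfolding in the chart. -/
theorem hasMVFDerivAt_iff {φ : M → F} {φ' : TangentSpace I x →L[ℝ] F} :
    HasMVFDerivAt I φ x φ' ↔ ContinuousAt φ x ∧
      HasFDerivWithinAt (fun z => φ ((extChartAt I x).symm z)) (φ' : E →L[ℝ] F) (Set.range I)
        (extChartAt I x x) := Iff.rfl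

theorem HasMVFDerivAt.mdifferentiableAt {φ : M → F} {φ' : TangentSpace I x →L[ℝ] F}
    (h : HasMVFDerivAt I φ x φ') : MDifferentiableAt I 𝓘(ℝ, F) φ x :=
  HasMFDerivAt.mdifferentiableAt h

theorem HasMVFDerivAt.mvfderiv {φ : M → F} {φ' : TangentSpace I x →L[ℝ] F}
    (h : HasMVFDerivAt I φ x φ') : mvfderiv I φ x = φ' :=
  HasMFDerivAt.mfderiv h

theorem _root_.MDifferentiableAt.hasMVFDerivAt {φ : M → F} (h : MDifferentiableAt I 𝓘(ℝ, F) φ x) :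
    HasMVFDerivAt I φ x (mvfderiv I φ x) :=
  h.hasMFDerivAt

theorem HasMVFDerivAt.unique {φ : M → F} {φ' φ'' : TangentSpace I x →L[ℝ] F}
    (h : HasMVFDerivAt I φ x φ') (h' : HasMVFDerivAt I φ x φ'') : φ' = φ'' :=
  h.mvfderiv.symm.trans h'.mvfderiv

theorem HasMVFDerivAt.congr_of_eventuallyEq {φ ψ : M → F} {φ' : TangentSpace I x →L[ℝ] F}
    (h : HasMVFDerivAt I φ x φ') (h' : ψ =ᶠ[𝓝 x] φ) : HasMVFDerivAt I ψ x φ' :=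
  HasMFDerivAt.congr_of_eventuallyEq h h'

theorem HasMVFDerivAt.congr_deriv {φ : M → F} {φ' φ'' : TangentSpace I x →L[ℝ] F}
    (h : HasMVFDerivAt I φ x φ') (h' : ∀ u, φ' u = φ'' u) : HasMVFDerivAt I φ x φ'' := by
  rwa [← show φ' = φ'' from ContinuousLinearMap.ext h']

theorem hasMVFDerivAt_const (c : F) : HasMVFDerivAt I (fun _ : M => c) x 0 :=
  hasMFDerivAt_const c x

theorem HasMVFDerivAt.clm_comp {φ : M → F} {φ' : TangentSpace I x →L[ℝ] F}
    (h : HasMVFDerivAt I φ x φ') (A : F →L[ℝ] G) :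
    HasMVFDerivAt I (fun y => A (φ y)) x (A ∘L φ') := by
  rw [hasMVFDerivAt_iff] at h ⊢
  exact ⟨A.continuous.continuousAt.comp h.1, A.hasFDerivAt.comp_hasFDerivWithinAt _ h.2⟩

theorem HasMVFDerivAt.clm_apply {A : M → F →L[ℝ] G} {A' : TangentSpace I x →L[ℝ] F →L[ℝ] G}
    {φ : M → F} {φ' : TangentSpace I x →L[ℝ] F} (hA : HasMVFDerivAt I A x A')
    (h : HasMVFDerivAt I φ x φ') :
    HasMVFDerivAt I (fun y => A y (φ y)) x (A x ∘L φ' + ContinuousLinearMap.apply ℝ G (φ x) ∘L A') := by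
  rw [hasMVFDerivAt_iff] at hA h ⊢
  have h2 := HasFDerivWithinAt.clm_apply hA.2 h.2
  simp only [extChartAt_to_inv] at h2
  exact ⟨hA.1.clm_apply h.1, h2.congr_fderiv (ContinuousLinearMap.ext fun u => rfl)⟩

theorem HasMVFDerivAt.multilinear_apply {m : ℕ}
    {φ : M → ContinuousMultilinearMap ℝ (fun _ : Fin m => F) G}
    {φ' : TangentSpace I x →L[ℝ] ContinuousMultilinearMap ℝ (fun _ : Fin m => F) G}
    {c : Fin m → M → F} {c' : ∀ _ : Fin m, TangentSpace I x →L[ℝ] F}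
    (hφ : HasMVFDerivAt I φ x φ') (hc : ∀ i, HasMVFDerivAt I (c i) x (c' i)) :
    HasMVFDerivAt I (fun y => φ y (fun i => c i y)) x
      (ContinuousMultilinearMap.apply ℝ (fun _ : Fin m => F) G (fun i => c i x) ∘L φ' +
        ∑ i, (φ x).toContinuousLinearMap (fun j => c j x) i ∘L c' i) := by
  simp only [hasMVFDerivAt_iff] at hφ hc ⊢
  have h2 := HasFDerivWithinAt.continuousMultilinearMap_apply hφ.2 (fun i => (hc i).2)
  simp only [extChartAt_to_inv] at h2
  refine ⟨?_, h2⟩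
  have h3 : Continuous fun p : ContinuousMultilinearMap ℝ (fun _ : Fin m => F) G × (Fin m → F) =>
      p.1 p.2 := by fun_prop
  exact ContinuousAt.comp (f := fun y => (φ y, fun i => c i y)) h3.continuousAt
    (hφ.1.prodMk (continuousAt_pi.2 fun i => (hc i).1))

theorem hasMVFDerivAt_pi {κ : Type*} [Fintype κ] {φ : M → κ → F}
    {φ' : ∀ _ : κ, TangentSpace I x →L[ℝ] F} (h : ∀ i, HasMVFDerivAt I (fun y => φ y i) x (φ' i)) :
    HasMVFDerivAt I φ x (ContinuousLinearMap.pi φ') := by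
  simp only [hasMVFDerivAt_iff] at h ⊢
  exact ⟨continuousAt_pi.2 fun i => (h i).1, hasFDerivWithinAt_pi.2 fun i => (h i).2⟩

/-- A function with values in multilinear forms on a finite-dimensional space is differentiable as
soon as its evaluations are. -/
theorem mdifferentiableAt_multilinear [FiniteDimensional ℝ F] {m : ℕ}
    {φ : M → ContinuousMultilinearMap ℝ (fun _ : Fin m => F) ℝ}
    (h : ∀ c : Fin m → F, MDifferentiableAt I 𝓘(ℝ, ℝ) (fun y => φ y c) x) :
    MDifferentiableAt I 𝓘(ℝ, ContinuousMultilinearMap ℝ (fun _ : Fin m => F) ℝ) φ x := by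
  let b := Module.finBasis ℝ F
  let J : ContinuousMultilinearMap ℝ (fun _ : Fin m => F) ℝ →ₗ[ℝ]
      ((Fin m → Fin (Module.finrank ℝ F)) → ℝ) :=
    { toFun := fun ψ a => ψ fun i => b (a i)
      map_add' := fun _ _ => rfl
      map_smul' := fun _ _ => rfl }
  have hJ : LinearMap.ker J = ⊥ := by
    rw [LinearMap.ker_eq_bot]
    intro ψ ψ' hψ
    have := Module.Basis.ext_multilinear (f := ψ.toMultilinearMap) (g := ψ'.toMultilinearMap)
      (fun _ => b) fun a => congrFun hψ a
    exact ContinuousMultilinearMap.toMultilinearMap_injective this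
  -- `φ` is recovered from its finitely many values on basis tuples by the linear map `K`, which is
  -- continuous by finite dimensionality.
  obtain ⟨K, hK⟩ := LinearMap.exists_leftInverse_of_injective J hJ
  have h1 : HasMVFDerivAt I (fun y => J (φ y)) x
      (ContinuousLinearMap.pi fun a => mvfderiv I (fun y => φ y fun i => b (a i)) x) :=
    hasMVFDerivAt_pi fun a => (h _).hasMVFDerivAt
  have h2 := (h1.clm_comp (LinearMap.toContinuousLinearMap K)).mdifferentiableAt
  exact h2.congr_of_eventuallyEq (Eventually.of_forall fun y => (LinearMap.congr_fun hK (φ y)).symm)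

end VectorValued

/-! ### Parallel multilinear forms and pullback connections -/

section Pullback

open Filter Topology

variable {EB : Type*} [NormedAddCommGroup EB] [NormedSpace ℝ EB]
  {HB : Type*} [TopologicalSpace HB] (IB : ModelWithCorners ℝ EB HB)
  {B : Type*} [TopologicalSpace B] [ChartedSpace HB B]
  (F : Type*) [NormedAddCommGroup F] [NormedSpace ℝ F]
  {V : B → Type*} [TopologicalSpace (TotalSpace F V)]
  [∀ x, AddCommGroup (V x)] [∀ x, Module ℝ (V x)] [∀ x, TopologicalSpace (V x)]
  [∀ x, IsTopologicalAddGroup (V x)] [∀ x, ContinuousSMul ℝ (V x)]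
  [FiberBundle F V] [VectorBundle ℝ F V]

variable {EN : Type*} [NormedAddCommGroup EN] [NormedSpace ℝ EN]
  {HN : Type*} [TopologicalSpace HN] (IN : ModelWithCorners ℝ EN HN)
  {N : Type*} [TopologicalSpace N] [ChartedSpace HN N]

variable {EP : Type*} [NormedAddCommGroup EP] [NormedSpace ℝ EP]
  {HP : Type*} [TopologicalSpace HP] (IP : ModelWithCorners ℝ EP HP)
  {P : Type*} [TopologicalSpace P] [ChartedSpace HP P]

variable {f : N → B}

/-- The multilinear form `β` on `f^* V` is differentiable at `x`, and parallel there for the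
connection `D`. -/
def IsParallelMultilinearAt (D : (∀ y, V (f y)) → ∀ y : N, TangentSpace IN y →L[ℝ] V (f y)) {m : ℕ}
    (β : ∀ y, ContinuousMultilinearMap ℝ (fun _ : Fin m => V (f y)) ℝ) (x : N) : Prop :=
  ∀ s : Fin m → ∀ y, V (f y),
    (∀ i, MDifferentiableAt IN (IB.prod 𝓘(ℝ, F)) (fun y => TotalSpace.mk' F (f y) (s i y)) x) →
    HasMVFDerivAt IN (fun y => β y (fun i => s i y)) x
      (∑ i, (β x).toContinuousLinearMap (fun i => s i x) i ∘L D (s i) x)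

theorem continuousLinearMapAt_eq (e : Trivialization F (TotalSpace.proj : TotalSpace F V → B))
    [e.IsLinear ℝ] {b : B} (hb : b ∈ e.baseSet) (v : V b) :
    e.continuousLinearMapAt ℝ b v = (e ⟨b, v⟩).2 := by
  simp [Trivialization.continuousLinearMapAt_apply, Trivialization.linearMapAt_apply, hb]

theorem mdifferentiableAt_of_localRep {s : ∀ y, V (f y)} {x : N} (hf : MDifferentiableAt IN IB f x)
    (hs : MDifferentiableAt IN 𝓘(ℝ, F)
      (fun z => (trivializationAt F V (f x)).continuousLinearMapAt ℝ (f z) (s z)) x) :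
    MDifferentiableAt IN (IB.prod 𝓘(ℝ, F)) (fun y => TotalSpace.mk' F (f y) (s y)) x := by
  rw [mdifferentiableAt_totalSpace]
  refine ⟨hf, hs.congr_of_eventuallyEq ?_⟩
  have hb := (trivializationAt F V (f x)).open_baseSet.mem_nhds
    (FiberBundle.mem_baseSet_trivializationAt' (f x))
  filter_upwards [hf.continuousAt.preimage_mem_nhds hb] with z hz
  exact (continuousLinearMapAt_eq F _ hz _).symm

theorem mdifferentiableAt_localExt_pullback {x : N} (hf : MDifferentiableAt IN IB f x)
    (v : V (f x)) :
    MDifferentiableAt IN (IB.prod 𝓘(ℝ, F)) (fun y => TotalSpace.mk' F (f y) (localExt F f v y)) x := by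
  refine mdifferentiableAt_of_localRep IB F IN hf ?_
  refine (mdifferentiableAt_const
    (c := (trivializationAt F V (f x)).continuousLinearMapAt ℝ (f x) v)).congr_of_eventuallyEq ?_
  have hb := (trivializationAt F V (f x)).open_baseSet.mem_nhds
    (FiberBundle.mem_baseSet_trivializationAt' (f x))
  filter_upwards [hf.continuousAt.preimage_mem_nhds hb] with z hz
  exact Trivialization.continuousLinearMapAt_symmL _ hz _

theorem localExt_self {x : N} (v : V (f x)) : localExt F f v x = v :=
  Trivialization.symmL_continuousLinearMapAt _ (FiberBundle.mem_baseSet_trivializationAt' (f x)) v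

/-- The representation of a multilinear form on `f^* V` in the preferred trivialization at `f x`. -/
noncomputable def localForm {m : ℕ} (β : ∀ y, ContinuousMultilinearMap ℝ (fun _ : Fin m => V (f y)) ℝ) (x y : N) :
    ContinuousMultilinearMap ℝ (fun _ : Fin m => F) ℝ :=
  (β y).compContinuousLinearMap fun _ => (trivializationAt F V (f x)).symmL ℝ (f y)

variable {IB F IN} in
theorem IsParallelMultilinearAt.hasMVFDerivAt_localForm_apply
    {D : (∀ y, V (f y)) → ∀ y : N, TangentSpace IN y →L[ℝ] V (f y)} {m : ℕ}
    {β : ∀ y, ContinuousMultilinearMap ℝ (fun _ : Fin m => V (f y)) ℝ} {x : N}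
    (hβ : IsParallelMultilinearAt IB F IN D β x) (hf : MDifferentiableAt IN IB f x)
    (v : Fin m → V (f x)) :
    HasMVFDerivAt IN (fun y => localForm F β x y
        fun i => (trivializationAt F V (f x)).continuousLinearMapAt ℝ (f x) (v i)) x
      (∑ i, (β x).toContinuousLinearMap v i ∘L D (localExt F f (v i)) x) := by
  have h1 := hβ (fun i => localExt F f (v i))
    fun i => mdifferentiableAt_localExt_pullback IB F IN hf (v i)
  simp only [localExt_self] at h1
  exact h1

variable {IB F IN} in
theorem IsParallelMultilinearAt.mdifferentiableAt_localForm [FiniteDimensional ℝ F]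
    {D : (∀ y, V (f y)) → ∀ y : N, TangentSpace IN y →L[ℝ] V (f y)} {m : ℕ}
    {β : ∀ y, ContinuousMultilinearMap ℝ (fun _ : Fin m => V (f y)) ℝ} {x : N}
    (hβ : IsParallelMultilinearAt IB F IN D β x) (hf : MDifferentiableAt IN IB f x) :
    MDifferentiableAt IN 𝓘(ℝ, ContinuousMultilinearMap ℝ (fun _ : Fin m => F) ℝ)
      (localForm F β x) x :=
  mdifferentiableAt_multilinear fun c => by
    have h := (hβ.hasMVFDerivAt_localForm_apply hf
      fun i => (trivializationAt F V (f x)).symmL ℝ (f x) (c i)).mdifferentiableAt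
    have hmem : f x ∈ (trivializationAt F V (f x)).baseSet :=
      FiberBundle.mem_baseSet_trivializationAt' (f x)
    simpa only [Trivialization.continuousLinearMapAt_symmL _ hmem] using h

theorem localForm_apply_continuousLinearMapAt {m : ℕ}
    (β : ∀ y, ContinuousMultilinearMap ℝ (fun _ : Fin m => V (f y)) ℝ) {x y : N}
    (hy : f y ∈ (trivializationAt F V (f x)).baseSet) (v : Fin m → V (f y)) :
    localForm F β x y (fun i => (trivializationAt F V (f x)).continuousLinearMapAt ℝ (f y) (v i)) =
      β y v := by
  simp only [localForm, ContinuousMultilinearMap.compContinuousLinearMap_apply]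
  congr 1
  funext i
  exact Trivialization.symmL_continuousLinearMapAt _ hy _

variable {IB F IN} in
/-- A differentiable form is continuous when evaluated on continuous sections along a map. -/
theorem IsParallelMultilinearAt.continuousWithinAt [FiniteDimensional ℝ F]
    {D : (∀ y, V (f y)) → ∀ y : N, TangentSpace IN y →L[ℝ] V (f y)} {m : ℕ}
    {β : ∀ y, ContinuousMultilinearMap ℝ (fun _ : Fin m => V (f y)) ℝ}
    {T : Type*} [TopologicalSpace T] {g : T → N} {A : Set T} {t : T}
    (hβ : IsParallelMultilinearAt IB F IN D β (g t)) (hf : MDifferentiableAt IN IB f (g t))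
    (hg : ContinuousWithinAt g A t) {s : Fin m → ∀ q, V (f (g q))}
    (hs : ∀ i, ContinuousWithinAt (fun q => TotalSpace.mk' F (f (g q)) (s i q)) A t) :
    ContinuousWithinAt (fun q => β (g q) fun i => s i q) A t := by
  have hmem : f (g t) ∈ (trivializationAt F V (f (g t))).baseSet :=
    FiberBundle.mem_baseSet_trivializationAt' (f (g t))
  have hc : ∀ i, ContinuousWithinAt
      (fun q => (trivializationAt F V (f (g t)) ⟨f (g q), s i q⟩).2) A t := fun i =>
    ((FiberBundle.continuousWithinAt_totalSpace F _).1 (hs i)).2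
  have hφ := (hβ.mdifferentiableAt_localForm hf).continuousAt.comp_continuousWithinAt hg
  have h3 : Continuous fun p : ContinuousMultilinearMap ℝ (fun _ : Fin m => F) ℝ × (Fin m → F) =>
      p.1 p.2 := by fun_prop
  have h4 := h3.continuousAt.comp_continuousWithinAt (hφ.prodMk (continuousWithinAt_pi.2 hc))
  have hfg : ContinuousWithinAt (fun q => f (g q)) A t :=
    hf.continuousAt.comp_continuousWithinAt hg
  refine h4.congr_of_eventuallyEq ?_ ?_
  · filter_upwards [hfg.preimage_mem_nhdsWithin
      ((trivializationAt F V (f (g t))).open_baseSet.mem_nhds hmem)] with q hq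
    have hq' : f (g q) ∈ (trivializationAt F V (f (g t))).baseSet := hq
    rw [← localForm_apply_continuousLinearMapAt F β hq']
    simp only [Function.comp_apply, continuousLinearMapAt_eq F _ hq']
  · rw [← localForm_apply_continuousLinearMapAt F β hmem]
    simp only [Function.comp_apply, continuousLinearMapAt_eq F _ hmem]

/-- A parallel form remains parallel for the pullback connection. -/
theorem IsParallelMultilinearAt.pullback [FiniteDimensional ℝ F]
    {D : (∀ y, V (f y)) → ∀ y : N, TangentSpace IN y →L[ℝ] V (f y)} {m : ℕ}
    {β : ∀ y, ContinuousMultilinearMap ℝ (fun _ : Fin m => V (f y)) ℝ} {g : P → N} {p : P}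
    (hβ : IsParallelMultilinearAt IB F IN D β (g p)) (hf : MDifferentiableAt IN IB f (g p))
    (hg : MDifferentiableAt IP IN g p) :
    IsParallelMultilinearAt IB F IP (f := fun q => f (g q)) (pullbackConnection F IN IP D g)
      (fun q => β (g q)) p := by
  intro s hs
  set e := trivializationAt F V (f (g p)) with he
  have hmem : f (g p) ∈ e.baseSet := FiberBundle.mem_baseSet_trivializationAt' (f (g p))
  have hφd := hβ.mdifferentiableAt_localForm hf
  have hφg : HasMVFDerivAt IP (fun q => localForm F β (g p) (g q)) p
      (mvfderiv IN (localForm F β (g p)) (g p) ∘L mfderiv IP IN g p) :=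
    HasMFDerivAt.comp (I' := IN) p hφd.hasMFDerivAt hg.hasMFDerivAt
  have hc : ∀ i, HasMVFDerivAt IP (fun q => e.continuousLinearMapAt ℝ (f (g q)) (s i q)) p _ :=
    fun i => (mdifferentiableAt_localRep (f := fun q => f (g q)) F (hs i)).hasMVFDerivAt
  have h1 := hφg.multilinear_apply hc
  have h2 : (fun q => β (g q) fun i => s i q) =ᶠ[𝓝 p] fun q => localForm F β (g p) (g q)
      fun i => e.continuousLinearMapAt ℝ (f (g q)) (s i q) := by
    filter_upwards [(hf.continuousAt.comp hg.continuousAt).preimage_mem_nhds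
      (e.open_baseSet.mem_nhds hmem)] with q hq
    have hq' : f (g q) ∈ e.baseSet := hq
    exact (localForm_apply_continuousLinearMapAt F β hq' _).symm
  refine (h1.congr_of_eventuallyEq h2).congr_deriv fun u => ?_
  -- Freezing the arguments in the trivialization amounts to inserting the sections `localExt`;
  -- parallelism upstairs then gives the derivative of the local form.
  have h3 : ∀ w, mvfderiv IN (localForm F β (g p)) (g p) w (fun i => e.continuousLinearMapAt ℝ (f (g p)) (s i p)) =
      ∑ i, β (g p) (Function.update (fun i => s i p) i (D (localExt F f (s i p)) (g p) w)) := by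
    intro w
    have h4 := hφd.hasMVFDerivAt.clm_comp (ContinuousMultilinearMap.apply ℝ (fun _ : Fin m => F) ℝ
      fun i => e.continuousLinearMapAt ℝ (f (g p)) (s i p))
    have h5 := congrArg (fun A : TangentSpace IN (g p) →L[ℝ] ℝ => A w)
      (h4.unique (hβ.hasMVFDerivAt_localForm_apply hf fun i => s i p))
    simpa using h5
  simp only [add_apply, ContinuousLinearMap.comp_apply,
    ContinuousMultilinearMap.apply_apply, sum_apply,
    ContinuousMultilinearMap.toContinuousLinearMap_apply, h3]
  -- For each slot, the two terms are the two summands of `pullbackConnection`: `D` on the frozen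
  -- section and the derivative of the local representative.
  rw [← Finset.sum_add_distrib]
  refine Finset.sum_congr rfl fun i _ => ?_
  simp only [pullbackConnection, add_apply, ContinuousLinearMap.comp_apply,
    ContinuousMultilinearMap.map_update_add]
  rw [add_comm]
  congr 1
  simp only [localForm, ContinuousMultilinearMap.compContinuousLinearMap_apply]
  congr 1
  funext j
  by_cases hj : j = i
  · subst hj; simp [he]
  · simp only [Function.update_of_ne hj]
    exact Trivialization.symmL_continuousLinearMapAt _ hmem _

end Pullback

end Calibrated

namespace Calibrated

/-! ### Invariance of parallel forms under holonomy -/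

section Holonomy

open Filter Topology

variable {EB : Type*} [NormedAddCommGroup EB] [NormedSpace ℝ EB]
  {HB : Type*} [TopologicalSpace HB] {IB : ModelWithCorners ℝ EB HB}
  {B : Type*} [TopologicalSpace B] [ChartedSpace HB B]
  {F : Type*} [NormedAddCommGroup F] [NormedSpace ℝ F]
  {V : B → Type*} [TopologicalSpace (TotalSpace F V)]
  [∀ x, AddCommGroup (V x)] [∀ x, Module ℝ (V x)] [∀ x, TopologicalSpace (V x)]
  [∀ x, IsTopologicalAddGroup (V x)] [∀ x, ContinuousSMul ℝ (V x)]
  [FiberBundle F V] [VectorBundle ℝ F V]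

variable {EN : Type*} [NormedAddCommGroup EN] [NormedSpace ℝ EN]
  {HN : Type*} [TopologicalSpace HN] {IN : ModelWithCorners ℝ EN HN}
  {N : Type*} [TopologicalSpace N] [ChartedSpace HN N] {f : N → B}

/-- The fundamental theorem of calculus allows a countable exceptional set, here the break points of
a piecewise smooth loop. -/
theorem eq_of_continuousOn_of_hasDerivAt_zero {h : ℝ → ℝ} (S : Finset ℝ)
    (hc : ContinuousOn h (Set.Icc 0 1))
    (hd : ∀ t ∈ Set.Ioo (0 : ℝ) 1, t ∉ S → HasDerivAt h 0 t) : h 1 = h 0 := by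
  have := MeasureTheory.integral_eq_of_hasDerivAt_off_countable_of_le h (fun _ => 0) zero_le_one
    S.countable_toSet hc (fun t ht => hd t ht.1 ht.2) (by simp)
  simp at this
  linarith

theorem IsPiecewiseSmooth.mdifferentiableAt {γ : ℝ → N} {S : Finset ℝ}
    (hγ : IsPiecewiseSmooth IN γ S) {t : ℝ} (ht : t ∈ Set.Ioo (0 : ℝ) 1) (htS : t ∉ S) :
    MDifferentiableAt 𝓘(ℝ, ℝ) IN γ t := by
  have hO : Set.Ioo (0 : ℝ) 1 ∩ (S : Set ℝ)ᶜ ∈ 𝓝 t :=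
    inter_mem (Ioo_mem_nhds ht.1 ht.2) (S.finite_toSet.isClosed.isOpen_compl.mem_nhds htS)
  obtain ⟨ε, hε, hεO⟩ := Metric.nhds_basis_closedBall.mem_iff.1 hO
  rw [Real.closedBall_eq_Icc] at hεO
  have h1 := (hεO ⟨le_rfl, by linarith⟩ : t - ε ∈ _)
  have h2 := (hεO ⟨by linarith, le_rfl⟩ : t + ε ∈ _)
  have h3 := hγ.2 (t - ε) (t + ε) h1.1.1.le (by linarith) h2.1.2.le fun r hr hr' =>
    (hεO ⟨hr'.1.le, hr'.2.le⟩).2 hr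
  exact (h3.contMDiffAt (Icc_mem_nhds (by linarith) (by linarith))).mdifferentiableAt (by simp)

/-- The ends of a loop equal the base point only propositionally, so vectors over them are compared
in the total space. -/
theorem evalMultilinear_eq_of_mk_eq {m : ℕ}
    (β : ∀ y, ContinuousMultilinearMap ℝ (fun _ : Fin m => V (f y)) ℝ) {x y : N} (hy : y = x)
    (s : Fin m → V (f y)) (v : Fin m → V (f x))
    (h : ∀ i, TotalSpace.mk' F (f y) (s i) = TotalSpace.mk' F (f x) (v i)) : β y s = β x v := by
  subst hy
  congr 1
  funext i
  exact TotalSpace.mk_inj.1 (h i)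

/-- Parallel forms are invariant under parallel transport around loops. -/
theorem restrictedHolonomy_preserves [FiniteDimensional ℝ F]
    {D : (∀ y, V (f y)) → ∀ y : N, TangentSpace IN y →L[ℝ] V (f y)} {m : ℕ}
    {β : ∀ y, ContinuousMultilinearMap ℝ (fun _ : Fin m => V (f y)) ℝ}
    (hβ : ∀ y, IsParallelMultilinearAt IB F IN D β y) (hf : MDifferentiable IN IB f) {x : N}
    {T : V (f x) →L[ℝ] V (f x)} (hT : T ∈ restrictedHolonomy IB F IN D x) (v : Fin m → V (f x)) :
    β x (fun i => T (v i)) = β x v := by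
  obtain ⟨γ, S, -, hγ, hs⟩ := hT
  choose s hs hs0 hs1 using fun i => hs (v i)
  have h0 := evalMultilinear_eq_of_mk_eq (F := F) β γ.extend_zero (fun i => s i 0) v hs0
  have h1 := evalMultilinear_eq_of_mk_eq (F := F) β γ.extend_one (fun i => s i 1) _ hs1
  rw [← h0, ← h1]
  refine eq_of_continuousOn_of_hasDerivAt_zero (h := fun t => β (γ.extend t) fun i => s i t) S
    (fun t ht => ?_) fun t ht htS => ?_
  · exact (hβ _).continuousWithinAt (hf _) (hγ.1 t ht) fun i => (hs i).1 t ht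
  · have h2 := (hβ (γ.extend t)).pullback IB F IN 𝓘(ℝ, ℝ) (hf _) (hγ.mdifferentiableAt ht htS)
      s fun i => ((hs i).2 t ht htS).1
    -- The pulled-back form is parallel and the sections are parallel, so every term of the
    -- derivative vanishes.
    have h3 : HasFDerivAt (fun t => β (γ.extend t) fun i => s i t) (0 : ℝ →L[ℝ] ℝ) t := by
      refine HasMFDerivAt.hasFDerivAt (h2.congr_deriv fun u => ?_)
      simp only [((hs _).2 t ht htS).2]
      simp
      rfl
    simpa using h3.hasDerivAt

end Holonomy

/-! ### The given forms and the metric as parallel multilinear forms on `M` -/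

section Ambient

open Filter Topology

variable {n : ℕ} {M : Type*} [TopologicalSpace M] [ChartedSpace (EuclideanSpace ℝ (Fin n)) M]
  [IsManifold (𝓡 n) ∞ M]

/-- The preferred trivialization of `TM` at `x` is inverse to the differential of the inverse chart,
so `formInChart` is the form read in that trivialization. Evaluation on differentiable sections is
then a product rule. -/
theorem IsSmoothForm.mdifferentiableAt_apply {m : ℕ}
    {β : ∀ x : M, TangentSpace (𝓡 n) x [⋀^Fin m]→L[ℝ] ℝ} (hβ : IsSmoothForm β) {x : M}
    {s : Fin m → ∀ y : M, TangentSpace (𝓡 n) y}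
    (hs : ∀ i, MDifferentiableAt (𝓡 n) ((𝓡 n).prod 𝓘(ℝ, EuclideanSpace ℝ (Fin n)))
      (fun y => TotalSpace.mk' (EuclideanSpace ℝ (Fin n)) y (s i y)) x) :
    MDifferentiableAt (𝓡 n) 𝓘(ℝ, ℝ) (fun y => β y fun i => s i y) x := by
  set E := EuclideanSpace ℝ (Fin n)
  have h1 : MDifferentiableAt (𝓡 n) 𝓘(ℝ, E [⋀^Fin m]→L[ℝ] ℝ)
      (fun y => formInChart β x (extChartAt (𝓡 n) x y)) x := by
    have h2 : DifferentiableAt ℝ (formInChart β x) (extChartAt (𝓡 n) x x) :=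
      ((hβ x).differentiableOn (by simp)).differentiableAt
        ((isOpen_extChartAt_target x).mem_nhds (mem_extChartAt_target x))
    exact h2.mdifferentiableAt.comp x (mdifferentiableAt_extChartAt (mem_chart_source _ x))
  have h3 := h1.hasMVFDerivAt.clm_comp
    (ContinuousAlternatingMap.toContinuousMultilinearMapCLM ℝ)
  have h4 : ∀ i, HasMVFDerivAt (𝓡 n) (fun y =>
      (trivializationAt E (TangentSpace (𝓡 n)) x).continuousLinearMapAt ℝ y (s i y)) x _ :=
    fun i => (mdifferentiableAt_localRep (f := fun y : M => y) E (hs i)).hasMVFDerivAt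
  refine (h3.multilinear_apply h4).mdifferentiableAt.congr_of_eventuallyEq ?_
  filter_upwards [(chartAt E x).open_source.mem_nhds (mem_chart_source _ x)] with y hy
  have hy' : y ∈ (trivializationAt E (TangentSpace (𝓡 n)) x).baseSet := by
    rwa [TangentBundle.trivializationAt_baseSet]
  have hy'' : (extChartAt (𝓡 n) x).symm (extChartAt (𝓡 n) x y) = y :=
    (extChartAt (𝓡 n) x).left_inv (by rwa [extChartAt_source])
  have h5 : formInChart β x (extChartAt (𝓡 n) x y) = (β y).compContinuousLinearMap
      ((trivializationAt E (TangentSpace (𝓡 n)) x).symmL ℝ y) := by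
    rw [TangentBundle.symmL_trivializationAt hy]
    simp only [formInChart, ModelWithCorners.range_eq_univ, mfderivWithin_univ]
    -- All tangent spaces are definitionally `E`; seen as a non-dependent function, `β` can be
    -- rewritten along `hy''`.
    let b : M → E [⋀^Fin m]→L[ℝ] ℝ := fun z => β z
    let A : E →L[ℝ] E := mfderiv 𝓘(ℝ, E) (𝓡 n) (extChartAt (𝓡 n) x).symm (extChartAt (𝓡 n) x y)
    exact congrArg (fun c : E [⋀^Fin m]→L[ℝ] ℝ => c.compContinuousLinearMap A) (congrArg b hy'')
  have h6 := congrArg (fun c : E [⋀^Fin m]→L[ℝ] ℝ => c fun i =>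
    (trivializationAt E (TangentSpace (𝓡 n)) x).continuousLinearMapAt ℝ y (s i y)) h5
  refine Eq.trans ?_ h6.symm
  simp only [ContinuousAlternatingMap.compContinuousLinearMap_apply]
  congr 1
  funext i
  exact (Trivialization.symmL_continuousLinearMapAt _ hy' _).symm

/-- A smooth parallel form, as a parallel multilinear form. -/
theorem IsParallelForm.isParallelMultilinearAt {m : ℕ}
    {D : (∀ x : M, TangentSpace (𝓡 n) x) → ∀ x : M,
      TangentSpace (𝓡 n) x →L[ℝ] TangentSpace (𝓡 n) x}
    {β : ∀ x : M, TangentSpace (𝓡 n) x [⋀^Fin m]→L[ℝ] ℝ} (hβ : IsSmoothForm β)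
    (h : IsParallelForm (𝓡 n) (EuclideanSpace ℝ (Fin n)) (𝓡 n) (f := fun x : M => x) D β) (x : M) :
    IsParallelMultilinearAt (𝓡 n) (EuclideanSpace ℝ (Fin n)) (𝓡 n) (f := fun x : M => x) D
      (fun y => (β y).toContinuousMultilinearMap) x := by
  intro s hs
  -- Smoothness supplies the differentiability that an equation for `mvfderiv` alone does not give.
  refine (hβ.mdifferentiableAt_apply hs).hasMVFDerivAt.congr_deriv fun u => ?_
  rw [h x u s hs]
  simp

variable [RiemannianBundle (fun x : M => TangentSpace (𝓡 n) x)]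
  [IsContMDiffRiemannianBundle (𝓡 n) ∞ (EuclideanSpace ℝ (Fin n))
    (fun x : M => TangentSpace (𝓡 n) x)]

/-- The metric is parallel for a metric connection. -/
theorem isParallelMultilinearAt_inner
    {nabla : CovariantDerivative (𝓡 n) (EuclideanSpace ℝ (Fin n))
      (fun x : M => TangentSpace (𝓡 n) x)} (h : nabla.IsMetricCompatible) (x : M) :
    IsParallelMultilinearAt (𝓡 n) (EuclideanSpace ℝ (Fin n)) (𝓡 n) (f := fun x : M => x) nabla
      (fun y => innerMultilinear (TangentSpace (𝓡 n) y)) x := by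
  classical
  intro s hs
  have h1 : MDifferentiableAt (𝓡 n) 𝓘(ℝ, ℝ) (fun y => ⟪s 0 y, s 1 y⟫_ℝ) x :=
    (hs 0).inner_bundle (hs 1)
  refine h1.hasMVFDerivAt.congr_deriv fun u => ?_
  -- Metric compatibility is stated for a vector field, but only its value at `x` enters, so no
  -- regularity is required of the field.
  have h2 := h.mvfderiv_inner_eq (x := x)
    (Function.update (fun y => (0 : TangentSpace (𝓡 n) y)) x u) (hs 0) (hs 1)
  simp only [Function.update_self] at h2
  rw [h2]
  simp [Fin.sum_univ_two]

end Ambient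

end Calibrated

namespace Calibrated

/-! ### Differentiable dependence of orthogonal projections -/

section Preliminaries

open Filter Topology ContinuousLinearMap

variable {E : Type*} [NormedAddCommGroup E] [NormedSpace ℝ E]
  {H : Type*} [TopologicalSpace H] {I : ModelWithCorners ℝ E H}
  {M : Type*} [TopologicalSpace M] [ChartedSpace H M] {x : M}
  {F : Type*} [NormedAddCommGroup F] [NormedSpace ℝ F] [FiniteDimensional ℝ F]
  {G : Type*} [NormedAddCommGroup G] [NormedSpace ℝ G] [FiniteDimensional ℝ G]

/-- A function with values in linear maps between finite-dimensional spaces is differentiable as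
soon as its evaluations are. -/
theorem mdifferentiableAt_clm {φ : M → F →L[ℝ] G}
    (h : ∀ c : F, MDifferentiableAt I 𝓘(ℝ, G) (fun y => φ y c) x) :
    MDifferentiableAt I 𝓘(ℝ, F →L[ℝ] G) φ x := by
  let b := Module.finBasis ℝ F
  let J : (F →L[ℝ] G) →ₗ[ℝ] (Fin (Module.finrank ℝ F) → G) :=
    { toFun := fun ψ a => ψ (b a)
      map_add' := fun _ _ => rfl
      map_smul' := fun _ _ => rfl }
  have hJ : LinearMap.ker J = ⊥ := by
    rw [LinearMap.ker_eq_bot]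
    intro ψ ψ' hψ
    have : (ψ : F →ₗ[ℝ] G) = ψ' := b.ext fun a => congrFun hψ a
    exact ContinuousLinearMap.coe_injective this
  obtain ⟨K, hK⟩ := LinearMap.exists_leftInverse_of_injective J hJ
  have h1 : HasMVFDerivAt I (fun y => J (φ y)) x
      (ContinuousLinearMap.pi fun a => mvfderiv I (fun y => φ y (b a)) x) :=
    hasMVFDerivAt_pi fun a => (h _).hasMVFDerivAt
  have h2 := (h1.clm_comp (LinearMap.toContinuousLinearMap K)).mdifferentiableAt
  exact h2.congr_of_eventuallyEq (Eventually.of_forall fun y => (LinearMap.congr_fun hK (φ y)).symm)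

variable {V W : Type*} [NormedAddCommGroup V] [InnerProductSpace ℝ V] [FiniteDimensional ℝ V]
  [NormedAddCommGroup W] [InnerProductSpace ℝ W] [FiniteDimensional ℝ W]

theorem isUnit_adjoint_comp_self {A : V →L[ℝ] W} (hA : Function.Injective A) :
    IsUnit (adjoint A ∘L A) := by
  have hinj : Function.Injective ((adjoint A ∘L A : V →L[ℝ] V) : V →ₗ[ℝ] V) := by
    rw [← LinearMap.ker_eq_bot, LinearMap.ker_eq_bot']
    intro v hv
    have h1 : ⟪A v, A v⟫_ℝ = 0 := by
      rw [← adjoint_inner_left]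
      have : (adjoint A) (A v) = 0 := hv
      rw [this, inner_zero_left]
    exact (map_eq_zero_iff A hA).1 (inner_self_eq_zero.1 h1)
  let e := LinearEquiv.ofInjectiveEndo _ hinj
  let e' : V ≃L[ℝ] V := e.toContinuousLinearEquiv
  exact ⟨ContinuousLinearEquiv.toUnit e', rfl⟩

/-- The residual is killed by `adjoint A`, hence orthogonal to the range. The formula makes the
projection a differentiable function of `A`. -/
theorem starProjection_range {A : V →L[ℝ] W} (hA : Function.Injective A) :
    (LinearMap.range (A : V →ₗ[ℝ] W)).starProjection =
      A ∘L Ring.inverse (adjoint A ∘L A) ∘L adjoint A := by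
  ext w
  refine Submodule.eq_starProjection_of_mem_of_inner_eq_zero ⟨_, rfl⟩ ?_
  rintro _ ⟨v, rfl⟩
  change ⟪w - A (Ring.inverse (adjoint A ∘L A) (adjoint A w)), A v⟫_ℝ = 0
  rw [← adjoint_inner_left, map_sub]
  have h := congrArg (fun T : V →L[ℝ] V => T (adjoint A w))
    (Ring.mul_inverse_cancel _ (isUnit_adjoint_comp_self hA))
  have h' : adjoint A (A (Ring.inverse (adjoint A ∘L A) (adjoint A w))) = adjoint A w := h
  rw [h', sub_self, inner_zero_left]

theorem differentiable_adjoint : Differentiable ℝ (fun A : V →L[ℝ] W => adjoint A) := by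
  let φ : (V →L[ℝ] W) →L[ℝ] (W →L[ℝ] V) :=
    { toFun := fun A => adjoint A
      map_add' := fun A B => map_add _ A B
      map_smul' := fun c A => by
        rw [LinearIsometryEquiv.map_smulₛₗ]
        rfl
      cont := adjoint.continuous }
  exact φ.differentiable

theorem differentiableAt_inverse_adjoint_comp_self {A : V →L[ℝ] W} (hA : Function.Injective A) :
    DifferentiableAt ℝ (fun A : V →L[ℝ] W => Ring.inverse (adjoint A ∘L A)) A := by
  have h1 : DifferentiableAt ℝ (fun A : V →L[ℝ] W => adjoint A ∘L A) A :=
    (differentiable_adjoint A).clm_comp differentiableAt_id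
  have h2 : DifferentiableAt ℝ (Ring.inverse : (V →L[ℝ] V) → V →L[ℝ] V) (adjoint A ∘L A) :=
    differentiableAt_inverse (isUnit_adjoint_comp_self hA)
  exact DifferentiableAt.comp (f := fun A : V →L[ℝ] W => adjoint A ∘L A) A h2 h1

theorem differentiableAt_starProjection_range {A : V →L[ℝ] W} (hA : Function.Injective A) :
    DifferentiableAt ℝ (fun A : V →L[ℝ] W => A ∘L Ring.inverse (adjoint A ∘L A) ∘L adjoint A) A :=
  differentiableAt_id.clm_comp
    ((differentiableAt_inverse_adjoint_comp_self hA).clm_comp (differentiable_adjoint A))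

end Preliminaries

/-! ### Volume forms of frames, encoding the determinant condition -/

section Volume

open ContinuousLinearMap

variable {n : ℕ} {V : Type*} [NormedAddCommGroup V] [InnerProductSpace ℝ V]

/-- The volume form of the orientation given by an orthonormal frame. -/
noncomputable def frameVolume (p : EuclideanSpace ℝ (Fin n) ≃ₗᵢ[ℝ] V) :
    ContinuousMultilinearMap ℝ (fun _ : Fin n => V) ℝ where
  toMultilinearMap := (((EuclideanSpace.basisFun (Fin n) ℝ).toBasis.map p.toLinearEquiv).det :
    V [⋀^Fin n]→ₗ[ℝ] ℝ).toMultilinearMap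
  cont := by
    have h : ∀ v : Fin n → V, ((EuclideanSpace.basisFun (Fin n) ℝ).toBasis.map p.toLinearEquiv).det v =
        Matrix.det (Matrix.of fun i j => (p.symm (v j)) i) := fun v => by
      rw [Module.Basis.det_apply]
      rfl
    change Continuous fun v : Fin n → V =>
      ((EuclideanSpace.basisFun (Fin n) ℝ).toBasis.map p.toLinearEquiv).det v
    simp only [h]
    refine Continuous.matrix_det ?_
    refine continuous_matrix fun i j => ?_
    exact (EuclideanSpace.proj i : EuclideanSpace ℝ (Fin n) →L[ℝ] ℝ).continuous.comp
      (p.symm.continuous.comp (continuous_apply j))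

theorem frameVolume_apply (p : EuclideanSpace ℝ (Fin n) ≃ₗᵢ[ℝ] V) (v : Fin n → V) :
    frameVolume p v = (EuclideanSpace.basisFun (Fin n) ℝ).toBasis.det (fun i => p.symm (v i)) :=
  Module.Basis.det_map _ _ _

/-- Lets the condition `det = 1` be treated as invariance of one more multilinear form. -/
theorem frameVolume_comp (p : EuclideanSpace ℝ (Fin n) ≃ₗᵢ[ℝ] V) (T : V →L[ℝ] V) (v : Fin n → V) :
    frameVolume p (fun i => T (v i)) = T.det * frameVolume p v :=
  Module.Basis.det_comp ((EuclideanSpace.basisFun (Fin n) ℝ).toBasis.map p.toLinearEquiv)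
    (T : V →ₗ[ℝ] V) v

theorem frameVolume_self (p : EuclideanSpace ℝ (Fin n) ≃ₗᵢ[ℝ] V) :
    frameVolume p (fun i => p (EuclideanSpace.basisFun (Fin n) ℝ i)) = 1 := by
  rw [frameVolume_apply]
  simp only [LinearIsometryEquiv.symm_apply_apply]
  exact (EuclideanSpace.basisFun (Fin n) ℝ).toBasis.det_self

theorem frameVolume_eq {p q : EuclideanSpace ℝ (Fin n) ≃ₗᵢ[ℝ] V}
    (h : ((q.trans p.symm).toContinuousLinearEquiv :
      EuclideanSpace ℝ (Fin n) →L[ℝ] EuclideanSpace ℝ (Fin n)).det = 1) :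
    frameVolume p = frameVolume q := by
  ext v
  rw [frameVolume_apply, frameVolume_apply]
  have h1 := Module.Basis.det_comp (EuclideanSpace.basisFun (Fin n) ℝ).toBasis
    (((q.trans p.symm).toContinuousLinearEquiv :
      EuclideanSpace ℝ (Fin n) →L[ℝ] EuclideanSpace ℝ (Fin n)) :
      EuclideanSpace ℝ (Fin n) →ₗ[ℝ] EuclideanSpace ℝ (Fin n)) (fun i => q.symm (v i))
  have h' : LinearMap.det (((q.trans p.symm).toContinuousLinearEquiv :
      EuclideanSpace ℝ (Fin n) →L[ℝ] EuclideanSpace ℝ (Fin n)) :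
      EuclideanSpace ℝ (Fin n) →ₗ[ℝ] EuclideanSpace ℝ (Fin n)) = 1 := h
  rw [h', one_mul] at h1
  rw [← h1]
  congr 1
  funext i
  simp

-- The one-parameter group of `X` has determinant `1`, hence fixes the volume form.
variable [FiniteDimensional ℝ V] in
theorem derivAction_frameVolume {N : ℕ} {deg : Fin (N + 1) → ℕ}
    {a : ∀ j, V [⋀^Fin (deg j)]→L[ℝ] ℝ} {X : V →L[ℝ] V} (hX : X ∈ infStab a)
    (p : EuclideanSpace ℝ (Fin n) ≃ₗᵢ[ℝ] V) (v : Fin n → V) :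
    derivAction X (frameVolume p) v = 0 := by
  refine (multilinear_exp_invariant_iff (frameVolume p) X).1 (fun t v => ?_) v
  rw [frameVolume_comp, (exp_smul_mem_of_mem_infStab hX t).2.1, one_mul]

end Volume

end Calibrated

namespace Calibrated

/-! ### Adapted frames along the immersion and the connection form -/

section LocalFrames

open Filter Topology

variable {n : ℕ} {M : Type*} [TopologicalSpace M] [ChartedSpace (EuclideanSpace ℝ (Fin n)) M]
  [IsManifold (𝓡 n) ∞ M] [RiemannianBundle (fun x : M => TangentSpace (𝓡 n) x)]
  [IsContMDiffRiemannianBundle (𝓡 n) ∞ (EuclideanSpace ℝ (Fin n))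
    (fun x : M => TangentSpace (𝓡 n) x)]
  {k : ℕ} {L : Type*} [TopologicalSpace L] [ChartedSpace (EuclideanSpace ℝ (Fin k)) L]
  [IsManifold (𝓡 k) ∞ L]
  {nabla : CovariantDerivative (𝓡 n) (EuclideanSpace ℝ (Fin n))
    (fun x : M => TangentSpace (𝓡 n) x)} {ι : C^∞⟮𝓡 k, L; 𝓡 n, M⟯}

theorem mdifferentiable_immersion (ι : C^∞⟮𝓡 k, L; 𝓡 n, M⟯) : MDifferentiable (𝓡 k) (𝓡 n) ι :=
  ι.contMDiff.mdifferentiable (by simp)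

/-- Differentiability at `x` of a section of `ι^* TM`. -/
def IsDiffSectionAt (ι : C^∞⟮𝓡 k, L; 𝓡 n, M⟯) (s : ∀ y : L, TangentSpace (𝓡 n) (ι y)) (x : L) :
    Prop :=
  MDifferentiableAt (𝓡 k) ((𝓡 n).prod 𝓘(ℝ, EuclideanSpace ℝ (Fin n)))
    (fun y => TotalSpace.mk' (EuclideanSpace ℝ (Fin n)) (ι y) (s y)) x

/-- An isometric trivialization of `ι^* TM` which is differentiable at `x`. -/
structure IsLocalFrame (ι : C^∞⟮𝓡 k, L; 𝓡 n, M⟯) (x : L)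
    (R : ∀ y, TangentSpace (𝓡 n) (ι y) ≃ₗᵢ[ℝ] TangentSpace (𝓡 n) (ι x)) : Prop where
  self : ∀ v, R x v = v
  smooth : ∀ w, IsDiffSectionAt ι (fun y => (R y).symm w) x

theorem IsGStructure.nonempty {N : ℕ} {deg : Fin (N + 1) → ℕ}
    {a : ∀ j, EuclideanSpace ℝ (Fin n) [⋀^Fin (deg j)]→L[ℝ] ℝ}
    {α : ∀ j, ∀ x : M, TangentSpace (𝓡 n) x [⋀^Fin (deg j)]→L[ℝ] ℝ}
    {Q : ∀ x : M, Set (EuclideanSpace ℝ (Fin n) ≃ₗᵢ[ℝ] TangentSpace (𝓡 n) x)}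
    (hQ : IsGStructure a α Q) (z : M) : (Q z).Nonempty := by
  obtain ⟨U, -, hz, p, hp, -⟩ := hQ.local_section z
  exact ⟨p z, hp z hz⟩

/-- For a local section `q` of adapted frames, `R y` is `q (ι x)` after the inverse of `q (ι y)`;
both frames represent `α j` by the same form. The choice `p` need not be continuous: adapted frames
at one point differ by determinant `1`, so they define the same volume. -/
theorem IsGStructure.exists_localFrame {N : ℕ} {deg : Fin (N + 1) → ℕ}
    {a : ∀ j, EuclideanSpace ℝ (Fin n) [⋀^Fin (deg j)]→L[ℝ] ℝ}
    {α : ∀ j, ∀ x : M, TangentSpace (𝓡 n) x [⋀^Fin (deg j)]→L[ℝ] ℝ}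
    {Q : ∀ x : M, Set (EuclideanSpace ℝ (Fin n) ≃ₗᵢ[ℝ] TangentSpace (𝓡 n) x)}
    (hQ : IsGStructure a α Q)
    {p : ∀ z : M, EuclideanSpace ℝ (Fin n) ≃ₗᵢ[ℝ] TangentSpace (𝓡 n) z} (hp : ∀ z, p z ∈ Q z)
    (ι : C^∞⟮𝓡 k, L; 𝓡 n, M⟯) (x : L) :
    ∃ R, IsLocalFrame ι x R ∧
      (∀ᶠ y in 𝓝 x, ∀ j v, α j (ι x) (fun i => R y (v i)) = α j (ι y) v) ∧
      ∀ᶠ y in 𝓝 x, ∀ v, frameVolume (p (ι x)) (fun i => R y (v i)) = frameVolume (p (ι y)) v := by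
  obtain ⟨U, hU, hxU, q, hq, hqs⟩ := hQ.local_section (ι x)
  have hUx : ∀ᶠ y in 𝓝 x, ι y ∈ U :=
    ι.contMDiff.continuous.continuousAt.preimage_mem_nhds (hU.mem_nhds hxU)
  have hvol : ∀ z ∈ U, frameVolume (p z) = frameVolume (q z) := fun z hz =>
    frameVolume_eq ((hQ.orbit z (p z) (hp z) (q z)).1 (hq z hz)).2.1
  refine ⟨fun y => (q (ι y)).symm.trans (q (ι x)), ⟨fun v => ?_, fun w => ?_⟩, ?_, ?_⟩
  · simp
  · have h1 := ((hqs ((q (ι x)).symm w)).contMDiffAt (hU.mem_nhds hxU)).mdifferentiableAt (by simp)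
    exact MDifferentiableAt.comp x h1 (mdifferentiable_immersion ι x)
  · filter_upwards [hUx] with y hy j v
    have h1 := hQ.forms (ι x) _ (hq _ hxU) j (fun i => (q (ι y)).symm (v i))
    have h2 := hQ.forms (ι y) _ (hq _ hy) j (fun i => (q (ι y)).symm (v i))
    simp only [LinearIsometryEquiv.apply_symm_apply] at h2
    exact h1.trans h2.symm
  · filter_upwards [hUx] with y hy v
    rw [hvol _ hxU, hvol _ hy, frameVolume_apply, frameVolume_apply]
    simp

variable {x : L} {R : ∀ y, TangentSpace (𝓡 n) (ι y) ≃ₗᵢ[ℝ] TangentSpace (𝓡 n) (ι x)}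

theorem connE_add {s t : ∀ y, TangentSpace (𝓡 n) (ι y)} (hs : IsDiffSectionAt ι s x)
    (ht : IsDiffSectionAt ι t x) :
    connE nabla ι (fun y => s y + t y) x = connE nabla ι s x + connE nabla ι t x :=
  pullbackConnection_add (EuclideanSpace ℝ (Fin n)) nabla.isCovariantDerivativeOn hs ht

theorem connE_smul {s : ∀ y, TangentSpace (𝓡 n) (ι y)} (hs : IsDiffSectionAt ι s x) (c : ℝ) :
    connE nabla ι (fun y => c • s y) x = c • connE nabla ι s x :=
  pullbackConnection_smul (EuclideanSpace ℝ (Fin n)) nabla.isCovariantDerivativeOn hs c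

/-- The connection form of `∇̄` in a local frame. -/
noncomputable def frameForm
    (nabla : CovariantDerivative (𝓡 n) (EuclideanSpace ℝ (Fin n))
      (fun x : M => TangentSpace (𝓡 n) x)) (hR : IsLocalFrame ι x R) (u : TangentSpace (𝓡 k) x) :
    TangentSpace (𝓡 n) (ι x) →L[ℝ] TangentSpace (𝓡 n) (ι x) :=
  LinearMap.toContinuousLinearMap
    { toFun := fun w => connE nabla ι (fun y => (R y).symm w) x u
      map_add' := fun v w => by
        simp only [map_add]
        rw [connE_add (hR.smooth v) (hR.smooth w)]
        rfl
      map_smul' := fun c v => by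
        simp only [map_smul]
        rw [connE_smul (hR.smooth v)]
        rfl }

theorem frameForm_apply (hR : IsLocalFrame ι x R) (u : TangentSpace (𝓡 k) x)
    (w : TangentSpace (𝓡 n) (ι x)) :
    frameForm nabla hR u w = connE nabla ι (fun y => (R y).symm w) x u := rfl

theorem isParallelMultilinearAt_inner_connE (h : nabla.IsMetricCompatible) (x : L) :
    IsParallelMultilinearAt (𝓡 n) (EuclideanSpace ℝ (Fin n)) (𝓡 k) (connE nabla ι)
      (fun y => innerMultilinear (TangentSpace (𝓡 n) (ι y))) x :=
  (isParallelMultilinearAt_inner h (ι x)).pullback (𝓡 n) _ (𝓡 n) (𝓡 k) mdifferentiableAt_id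
    (mdifferentiable_immersion ι x)

/-- A form which is preserved by a local frame and parallel is annihilated by the connection
form. -/
theorem derivAction_frameForm {m : ℕ}
    {β : ∀ y, ContinuousMultilinearMap ℝ (fun _ : Fin m => TangentSpace (𝓡 n) (ι y)) ℝ}
    (hβ : IsParallelMultilinearAt (𝓡 n) (EuclideanSpace ℝ (Fin n)) (𝓡 k) (connE nabla ι) β x)
    (hR : IsLocalFrame ι x R) (hRβ : ∀ᶠ y in 𝓝 x, ∀ v, β x (fun i => R y (v i)) = β y v)
    (u : TangentSpace (𝓡 k) x) (w : Fin m → TangentSpace (𝓡 n) (ι x)) :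
    derivAction (frameForm nabla hR u) (β x) w = 0 := by
  have hR0 : ∀ w, (R x).symm w = w := fun w => (R x).symm_apply_eq.2 (hR.self w).symm
  have h1 := hβ (fun i y => (R y).symm (w i)) fun i => hR.smooth (w i)
  have h2 : HasMVFDerivAt (𝓡 k) (fun y => β y fun i => (R y).symm (w i)) x 0 := by
    refine (hasMVFDerivAt_const (β x w)).congr_of_eventuallyEq ?_
    filter_upwards [hRβ] with y hy
    rw [← hy]
    simp
  have h3 := congrArg (fun A : TangentSpace (𝓡 k) x →L[ℝ] ℝ => A u) (h1.unique h2)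
  simp only [hR0] at h3
  simpa [derivAction, frameForm_apply] using h3

/-- In the frame, `∇̄ = d + ω`. Pair `R y (s y)` with a fixed vector `w`, which is the same as
pairing `s` with a frame section, and use metric compatibility; skewness of `ω` moves it from `w` to
`s x`. -/
theorem IsLocalFrame.hasMVFDerivAt (h : nabla.IsMetricCompatible) (hR : IsLocalFrame ι x R)
    {s : ∀ y, TangentSpace (𝓡 n) (ι y)} (hs : IsDiffSectionAt ι s x) :
    ∃ S', HasMVFDerivAt (𝓡 k) (fun y => R y (s y)) x S' ∧
      ∀ u, connE nabla ι s x u = S' u + frameForm nabla hR u (s x) := by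
  have hR0 : ∀ w, (R x).symm w = w := fun w => (R x).symm_apply_eq.2 (hR.self w).symm
  have hinner := isParallelMultilinearAt_inner_connE (ι := ι) h x
  let b := stdOrthonormalBasis ℝ (TangentSpace (𝓡 n) (ι x))
  have h1 : ∀ w, HasMVFDerivAt (𝓡 k) (fun y => ⟪w, R y (s y)⟫_ℝ) x _ := fun w => by
    have h2 := hinner ![fun y => (R y).symm w, s] fun i => by
      fin_cases i
      · exact hR.smooth w
      · exact hs
    refine h2.congr_of_eventuallyEq (Eventually.of_forall fun y => ?_)
    simp only [innerMultilinear_apply]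
    exact ((R y).symm.inner_map_eq_flip _ _).symm
  have h2 : MDifferentiableAt (𝓡 k) 𝓘(ℝ, TangentSpace (𝓡 n) (ι x)) (fun y => R y (s y)) x := by
    have h3 := (hasMVFDerivAt_pi (φ := fun y i => ⟪b i, R y (s y)⟫_ℝ) fun i => h1 (b i)).clm_comp
      (LinearMap.toContinuousLinearMap
        (b.toBasis.equivFun.symm : (_ → ℝ) →ₗ[ℝ] TangentSpace (𝓡 n) (ι x)))
    refine h3.mdifferentiableAt.congr_of_eventuallyEq (Eventually.of_forall fun y => ?_)
    simp only [LinearMap.coe_toContinuousLinearMap', LinearEquiv.coe_coe,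
      Module.Basis.equivFun_symm_apply, OrthonormalBasis.coe_toBasis]
    exact (b.sum_repr' _).symm
  refine ⟨_, h2.hasMVFDerivAt, fun u => ext_inner_left ℝ fun w => ?_⟩
  have h3 := h2.hasMVFDerivAt.clm_comp (innerSL ℝ w)
  have h4 := congrArg (fun A : TangentSpace (𝓡 k) x →L[ℝ] ℝ => A u) (h3.unique (h1 w))
  have h5 := derivAction_frameForm hinner hR
    (Eventually.of_forall fun y v => (R y).inner_map_map _ _) u ![w, s x]
  simp [Fin.sum_univ_two, hR0] at h4
  simp [derivAction_innerMultilinear, frameForm_apply] at h5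
  rw [inner_add_right, h4, frameForm_apply]
  linarith

theorem IsLocalFrame.mdifferentiableAt_symm (hR : IsLocalFrame ι x R)
    {S : L → TangentSpace (𝓡 n) (ι x)}
    (hS : MDifferentiableAt (𝓡 k) 𝓘(ℝ, TangentSpace (𝓡 n) (ι x)) S x) :
    IsDiffSectionAt ι (fun y => (R y).symm (S y)) x := by
  refine mdifferentiableAt_of_localRep (𝓡 n) _ (𝓡 k) (mdifferentiable_immersion ι x) ?_
  have h1 : MDifferentiableAt (𝓡 k)
      𝓘(ℝ, TangentSpace (𝓡 n) (ι x) →L[ℝ] EuclideanSpace ℝ (Fin n))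
      (fun y => (trivializationAt (EuclideanSpace ℝ (Fin n)) (TangentSpace (𝓡 n))
        (ι x)).continuousLinearMapAt ℝ (ι y) ∘L
          ((R y).symm.toContinuousLinearEquiv : TangentSpace (𝓡 n) (ι x) →L[ℝ] _)) x :=
    mdifferentiableAt_clm fun c =>
      mdifferentiableAt_localRep (f := ι) (EuclideanSpace ℝ (Fin n)) (hR.smooth c)
  exact (h1.hasMVFDerivAt.clm_apply hS.hasMVFDerivAt).mdifferentiableAt

/-- Converse of `derivAction_frameForm`: a form constant in the frame and annihilated by `ω` is
parallel. Needed for the volume form, whose parallelism is not among the hypotheses. -/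
theorem IsLocalFrame.isParallelMultilinearAt (h : nabla.IsMetricCompatible)
    (hR : IsLocalFrame ι x R) {m : ℕ}
    {β : ∀ y, ContinuousMultilinearMap ℝ (fun _ : Fin m => TangentSpace (𝓡 n) (ι y)) ℝ}
    (hRβ : ∀ᶠ y in 𝓝 x, ∀ v, β x (fun i => R y (v i)) = β y v)
    (hω : ∀ u w, derivAction (frameForm nabla hR u) (β x) w = 0) :
    IsParallelMultilinearAt (𝓡 n) (EuclideanSpace ℝ (Fin n)) (𝓡 k) (connE nabla ι) β x := by
  intro s hs
  choose S' hS' hS'' using fun i => hR.hasMVFDerivAt h (hs i)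
  have h1 := (hasMVFDerivAt_const (I := 𝓡 k) (β x)).multilinear_apply hS'
  refine (h1.congr_of_eventuallyEq ?_).congr_deriv fun u => ?_
  · filter_upwards [hRβ] with y hy
    exact (hy _).symm
  · have h2 := hω u (fun i => s i x)
    simp only [derivAction] at h2
    simp [hS'', hR.self, Finset.sum_add_distrib, h2]

end LocalFrames

end Calibrated

namespace Calibrated

/-! ### The covariant derivative of the tangential projection -/

section Planes

open Filter Topology

variable {n : ℕ} {M : Type*} [TopologicalSpace M] [ChartedSpace (EuclideanSpace ℝ (Fin n)) M]
  [IsManifold (𝓡 n) ∞ M] [RiemannianBundle (fun x : M => TangentSpace (𝓡 n) x)]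
  [IsContMDiffRiemannianBundle (𝓡 n) ∞ (EuclideanSpace ℝ (Fin n))
    (fun x : M => TangentSpace (𝓡 n) x)]
  {k : ℕ} {L : Type*} [TopologicalSpace L] [ChartedSpace (EuclideanSpace ℝ (Fin k)) L]
  [IsManifold (𝓡 k) ∞ L]
  {nabla : CovariantDerivative (𝓡 n) (EuclideanSpace ℝ (Fin n))
    (fun x : M => TangentSpace (𝓡 n) x)} {ι : C^∞⟮𝓡 k, L; 𝓡 n, M⟯}
  {x : L} {R : ∀ y, TangentSpace (𝓡 n) (ι y) ≃ₗᵢ[ℝ] TangentSpace (𝓡 n) (ι x)}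

/-- The tangent planes of the immersion, transported to a fixed fibre by a local frame. -/
noncomputable def transportedPlane (R : ∀ y, TangentSpace (𝓡 n) (ι y) ≃ₗᵢ[ℝ] TangentSpace (𝓡 n) (ι x)) (y : L) :
    Submodule ℝ (TangentSpace (𝓡 n) (ι x)) :=
  (tangentPlane ι y).map ((R y).toLinearEquiv : TangentSpace (𝓡 n) (ι y) →ₗ[ℝ] _)

theorem IsLocalFrame.transportedPlane_self (hR : IsLocalFrame ι x R) :
    transportedPlane R x = tangentPlane ι x := by
  have h : ((R x).toLinearEquiv : TangentSpace (𝓡 n) (ι x) →ₗ[ℝ] _) = LinearMap.id :=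
    LinearMap.ext hR.self
  rw [transportedPlane, h, Submodule.map_id]

theorem map_projT (y : L) (v : TangentSpace (𝓡 n) (ι y)) :
    R y (projT ι y v) = (transportedPlane R y).starProjection (R y v) := by
  have := Submodule.starProjection_map_apply (R y) (tangentPlane ι y) (R y v)
  rw [LinearIsometryEquiv.symm_apply_apply] at this
  exact this.symm

theorem isCalibratedPlane_transportedPlane {m : ℕ}
    {β : ∀ x : M, TangentSpace (𝓡 n) x [⋀^Fin m]→L[ℝ] ℝ} {y : L}
    (hy : ∀ v, β (ι x) (fun i => R y (v i)) = β (ι y) v)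
    (h : IsCalibratedPlane (β (ι y)) (tangentPlane ι y)) :
    IsCalibratedPlane (β (ι x)) (transportedPlane R y) := by
  obtain ⟨e, he⟩ := h
  refine ⟨e.map (LinearIsometryEquiv.submoduleMap (tangentPlane ι y) (R y)), ?_⟩
  rw [← he, ← hy]
  rfl

/-- The transported tangent plane is the range of an injective map `A y` depending differentiably on
`y`, so the explicit formula for the projection applies. -/
theorem IsLocalFrame.mdifferentiableAt_starProjection (h : nabla.IsMetricCompatible)
    (hι : ∀ x, Function.Injective (mfderiv (𝓡 k) (𝓡 n) ι x)) (hR : IsLocalFrame ι x R) :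
    MDifferentiableAt (𝓡 k) 𝓘(ℝ, TangentSpace (𝓡 n) (ι x) →L[ℝ] TangentSpace (𝓡 n) (ι x))
      (fun y => (transportedPlane R y).starProjection) x := by
  set e := trivializationAt (EuclideanSpace ℝ (Fin k)) (TangentSpace (𝓡 k) : L → Type _) x with he
  have hx : x ∈ e.baseSet := FiberBundle.mem_baseSet_trivializationAt' x
  let A : L → EuclideanSpace ℝ (Fin k) →L[ℝ] TangentSpace (𝓡 n) (ι x) := fun y =>
    ((R y).toContinuousLinearEquiv : TangentSpace (𝓡 n) (ι y) →L[ℝ] TangentSpace (𝓡 n) (ι x)) ∘L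
      mfderiv (𝓡 k) (𝓡 n) ι y ∘L e.symmL ℝ y
  have hA : MDifferentiableAt (𝓡 k)
      𝓘(ℝ, EuclideanSpace ℝ (Fin k) →L[ℝ] TangentSpace (𝓡 n) (ι x)) A x := by
    refine mdifferentiableAt_clm fun c => ?_
    have h1 := mdifferentiableAt_pushforward ι (x := x) (e.symmL ℝ x c)
    obtain ⟨S', hS', -⟩ := hR.hasMVFDerivAt h h1
    refine hS'.mdifferentiableAt.congr_of_eventuallyEq (Eventually.of_forall fun y => ?_)
    have h2 : e.continuousLinearMapAt ℝ x (e.symmL ℝ x c) = c :=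
      Trivialization.continuousLinearMapAt_symmL _ hx c
    simp only [localExt, ← he, h2]
    rfl
  have hinj : ∀ y ∈ e.baseSet, Function.Injective (A y) := fun y hy => by
    refine (R y).injective.comp ((hι y).comp ?_)
    exact Function.LeftInverse.injective (g := e.continuousLinearMapAt ℝ y)
      fun c => Trivialization.continuousLinearMapAt_symmL _ hy c
  have hrange : ∀ y ∈ e.baseSet, transportedPlane R y =
      LinearMap.range (A y : EuclideanSpace ℝ (Fin k) →ₗ[ℝ] _) := fun y hy => by
    ext w
    constructor
    · rintro ⟨_, ⟨v, rfl⟩, rfl⟩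
      refine ⟨e.continuousLinearMapAt ℝ y v, ?_⟩
      have : e.symmL ℝ y (e.continuousLinearMapAt ℝ y v) = v :=
        Trivialization.symmL_continuousLinearMapAt _ hy v
      change R y (mfderiv (𝓡 k) (𝓡 n) ι y (e.symmL ℝ y (e.continuousLinearMapAt ℝ y v))) = _
      rw [this]
      rfl
    · rintro ⟨c, rfl⟩
      exact ⟨_, ⟨e.symmL ℝ y c, rfl⟩, rfl⟩
  have h3 := (differentiableAt_starProjection_range (hinj x hx)).mdifferentiableAt.comp x hA
  refine h3.congr_of_eventuallyEq ?_
  filter_upwards [e.open_baseSet.mem_nhds hx] with y hy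
  simp only [Function.comp_apply]
  rw [← starProjection_range (hinj y hy)]
  congr 1
  exact hrange y hy

/-- A straight line in the chart realizes `u`; this reduces a directional derivative on `L` to
curves of planes in one vector space. -/
theorem hasDerivAt_comp_chartLine {G : Type*} [NormedAddCommGroup G] [NormedSpace ℝ G] {φ : L → G}
    {φ' : TangentSpace (𝓡 k) x →L[ℝ] G} (h : HasMVFDerivAt (𝓡 k) φ x φ')
    (u : TangentSpace (𝓡 k) x) :
    ∃ γ : ℝ → L, γ 0 = x ∧ ContinuousAt γ 0 ∧ HasDerivAt (fun t => φ (γ t)) (φ' u) 0 := by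
  have key : ∀ (A : EuclideanSpace ℝ (Fin k) →L[ℝ] G) (w : EuclideanSpace ℝ (Fin k)),
      HasFDerivWithinAt (fun z => φ ((extChartAt (𝓡 k) x).symm z)) A (Set.range (𝓡 k))
        (extChartAt (𝓡 k) x x) →
      ∃ γ : ℝ → L, γ 0 = x ∧ ContinuousAt γ 0 ∧ HasDerivAt (fun t => φ (γ t)) (A w) 0 := by
    intro A w hA
    have hA' := hA.hasFDerivAt (by rw [ModelWithCorners.range_eq_univ]; exact Filter.univ_mem)
    have hc : HasDerivAt (fun t : ℝ => extChartAt (𝓡 k) x x + t • w) w 0 := by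
      simpa using ((hasDerivAt_id (0 : ℝ)).smul_const w).const_add (extChartAt (𝓡 k) x x)
    have hc0 : extChartAt (𝓡 k) x x + (0 : ℝ) • w = extChartAt (𝓡 k) x x := by simp
    refine ⟨fun t => (extChartAt (𝓡 k) x).symm (extChartAt (𝓡 k) x x + t • w), ?_, ?_, ?_⟩
    · simp only [hc0, extChartAt_to_inv]
    · have h1 : ContinuousAt (extChartAt (𝓡 k) x).symm (extChartAt (𝓡 k) x x + (0 : ℝ) • w) := by
        rw [hc0]; exact continuousAt_extChartAt_symm x
      exact ContinuousAt.comp (f := fun t : ℝ => extChartAt (𝓡 k) x x + t • w) h1 hc.continuousAt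
    · exact hA'.comp_hasDerivAt_of_eq (0 : ℝ) hc hc0.symm
  exact key φ' u (hasMVFDerivAt_iff.1 h).2

variable {N : ℕ} {deg : Fin (N + 1) → ℕ}
  {α : ∀ j, ∀ x : M, TangentSpace (𝓡 n) x [⋀^Fin (deg j)]→L[ℝ] ℝ}

theorem IsParallelCompliant.isParallelMultilinearAt_connE (hα : IsParallelCompliant nabla α)
    (j : Fin (N + 1)) (x : L) :
    IsParallelMultilinearAt (𝓡 n) (EuclideanSpace ℝ (Fin n)) (𝓡 k) (connE nabla ι)
      (fun y => (α j (ι y)).toContinuousMultilinearMap) x := by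
  have h1 := (hα.parallel j).isParallelMultilinearAt (hα.smooth j) (ι x)
  exact h1.pullback (𝓡 n) _ (𝓡 n) (𝓡 k) mdifferentiableAt_id (mdifferentiable_immersion ι x)

/-- The metric and the `α j` are both constant in the frame and parallel, so `ω_u` annihilates them.
-/
theorem IsParallelCompliant.frameForm_mem_infStab (hα : IsParallelCompliant nabla α)
    (h : nabla.IsMetricCompatible) (hR : IsLocalFrame ι x R)
    (hRα : ∀ᶠ y in 𝓝 x, ∀ j v, α j (ι x) (fun i => R y (v i)) = α j (ι y) v)
    (u : TangentSpace (𝓡 k) x) :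
    frameForm nabla hR u ∈ infStab (fun j => α j (ι x)) := by
  refine ⟨fun v => ?_, fun j v => ?_⟩
  · exact derivAction_frameForm (isParallelMultilinearAt_inner_connE h x) hR
      (Eventually.of_forall fun y v => (R y).inner_map_map _ _) u v
  · exact derivAction_frameForm (hα.isParallelMultilinearAt_connE j x) hR
      (hRα.mono fun y hy v => hy j v) u v

theorem IsLocalFrame.isDiffSectionAt_projT (h : nabla.IsMetricCompatible)
    (hι : ∀ x, Function.Injective (mfderiv (𝓡 k) (𝓡 n) ι x)) (hR : IsLocalFrame ι x R)
    {s : ∀ y, TangentSpace (𝓡 n) (ι y)} (hs : IsDiffSectionAt ι s x) :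
    IsDiffSectionAt ι (fun y => projT ι y (s y)) x := by
  obtain ⟨S', hS', -⟩ := hR.hasMVFDerivAt h hs
  have h1 := (hR.mdifferentiableAt_starProjection h hι).hasMVFDerivAt.clm_apply hS'
  refine (hR.mdifferentiableAt_symm h1.mdifferentiableAt).congr_of_eventuallyEq
    (Eventually.of_forall fun y => ?_)
  simp only [← map_projT, LinearIsometryEquiv.symm_apply_apply]

/-- The Leibniz rule for `∇̄ = d + ω` acting on endomorphisms: `∇̄_u π = dπ(u) + [ω_u, π]`. -/
theorem IsLocalFrame.connE_projT (h : nabla.IsMetricCompatible)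
    (hι : ∀ x, Function.Injective (mfderiv (𝓡 k) (𝓡 n) ι x)) (hR : IsLocalFrame ι x R)
    {s : ∀ y, TangentSpace (𝓡 n) (ι y)} (hs : IsDiffSectionAt ι s x) (u : TangentSpace (𝓡 k) x) :
    connE nabla ι (fun y => projT ι y (s y)) x u = projT ι x (connE nabla ι s x u) +
      (mvfderiv (𝓡 k) (fun y => (transportedPlane R y).starProjection) x u +
        (frameForm nabla hR u * projT ι x - projT ι x * frameForm nabla hR u)) (s x) := by
  obtain ⟨S', hS', hS⟩ := hR.hasMVFDerivAt h hs
  have h1 := (hR.mdifferentiableAt_starProjection h hι).hasMVFDerivAt.clm_apply hS'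
  obtain ⟨T', hT', hT⟩ := hR.hasMVFDerivAt h (hR.isDiffSectionAt_projT h hι hs)
  have h3 : T' = _ := hT'.unique (h1.congr_of_eventuallyEq (Eventually.of_forall fun y =>
    map_projT y (s y)))
  have h5 : T' u = projT ι x (S' u) +
      mvfderiv (𝓡 k) (fun y => (transportedPlane R y).starProjection) x u (s x) := by
    rw [h3]
    simp only [hR.transportedPlane_self, hR.self]
    rfl
  have h6 : ∀ (A C P : TangentSpace (𝓡 n) (ι x) →L[ℝ] TangentSpace (𝓡 n) (ι x))
      (v w t : TangentSpace (𝓡 n) (ι x)), t = P v + A w →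
        t + C (P w) = P (v + C w) + (A + (C * P - P * C)) w := by
    intro A C P v w t ht
    rw [ht, map_add]
    change _ = _ + (A w + (C (P w) - P (C w)))
    abel
  rw [hT u, hS u]
  exact h6 _ _ _ _ _ _ h5

/-- In the direction `u` at `x`, the tangential projection differentiates to the commutator with
`X`. -/
def IsProjectionGenerator (nabla : CovariantDerivative (𝓡 n) (EuclideanSpace ℝ (Fin n))
    (fun x : M => TangentSpace (𝓡 n) x)) (ι : C^∞⟮𝓡 k, L; 𝓡 n, M⟯) (x : L)
    (u : TangentSpace (𝓡 k) x) (X : TangentSpace (𝓡 n) (ι x) →L[ℝ] TangentSpace (𝓡 n) (ι x)) :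
    Prop :=
  X ∈ offDiagonal (tangentPlane ι x) ∧
    ∀ s, IsDiffSectionAt ι s x → IsDiffSectionAt ι (fun y => projT ι y (s y)) x ∧
      connE nabla ι (fun y => projT ι y (s y)) x u =
        projT ι x (connE nabla ι s x u) + (X * projT ι x - projT ι x * X) (s x)

/-- Along a calibrated immersion, the covariant derivative of the tangential projection in the
direction `u` is its commutator with an element of the Lie algebra which exchanges the tangent and
the normal space. -/
theorem IsParallelCompliant.exists_projectionGenerator (hα : IsParallelCompliant nabla α)
    (h : nabla.IsMetricCompatible) (hι : ∀ x, Function.Injective (mfderiv (𝓡 k) (𝓡 n) ι x))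
    (hL : ∀ x, IsCalibratedPlane (α 0 (ι x)) (tangentPlane ι x)) (x : L)
    (u : TangentSpace (𝓡 k) x) :
    ∃ X ∈ infStab (fun j => α j (ι x)), IsProjectionGenerator nabla ι x u X := by
  obtain ⟨a, Q, hQ⟩ := hα.gStructure
  choose p hp using hQ.nonempty
  obtain ⟨R, hR, hRα, -⟩ := hQ.exists_localFrame hp ι x
  have hω := hα.frameForm_mem_infStab h hR hRα u
  obtain ⟨γ, hγ0, hγc, hγ⟩ := hasDerivAt_comp_chartLine
    (hR.mdifferentiableAt_starProjection h hι).hasMVFDerivAt u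
  have hcal : ∀ᶠ t in 𝓝 (0 : ℝ), IsCalibratedPlane (α 0 (ι x)) (transportedPlane R (γ t)) := by
    have h1 : ∀ᶠ y in 𝓝 (γ 0), IsCalibratedPlane (α 0 (ι x)) (transportedPlane R y) := by
      rw [hγ0]
      filter_upwards [hRα] with y hy
      exact isCalibratedPlane_transportedPlane (hy 0) (hL y)
    exact hγc.eventually h1
  -- The velocity of the transported planes and the bracket with `ω_u` combine into the bracket with
  -- one off-diagonal element.
  obtain ⟨X, hX, hXo, hXc⟩ := (hα.compliant (ι x)).exists_offDiagonal_generator hcal hγ hω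
  simp only [hγ0, hR.transportedPlane_self] at hXo hXc
  refine ⟨X, hX, hXo, fun s hs => ⟨hR.isDiffSectionAt_projT h hι hs, ?_⟩⟩
  rw [hR.connE_projT h hι hs u]
  exact congrArg (fun A : TangentSpace (𝓡 n) (ι x) →L[ℝ] TangentSpace (𝓡 n) (ι x) =>
    projT ι x (connE nabla ι s x u) + A (s x)) hXc

end Planes

end Calibrated

namespace Calibrated

/-! ### Block identities for off-diagonal endomorphisms -/

section OffDiagonal

variable {V : Type*} [NormedAddCommGroup V] [InnerProductSpace ℝ V] [FiniteDimensional ℝ V]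
  {W : Submodule ℝ V} {X : V →L[ℝ] V}

theorem starProjection_offDiagonal_starProjection (hX : X ∈ offDiagonal W) (v : V) :
    W.starProjection (X (W.starProjection v)) = 0 :=
  (Submodule.starProjection_apply_eq_zero_iff W).2
    (hX.2.1 _ (Submodule.starProjection_apply_mem W v))

theorem starProjection_offDiagonal (hX : X ∈ offDiagonal W) (v : V) :
    W.starProjection (X v) = X v - X (W.starProjection v) := by
  have h1 : W.starProjection (X (v - W.starProjection v)) = X (v - W.starProjection v) :=
    Submodule.starProjection_eq_self_iff.2
      (hX.2.2 _ (Submodule.sub_starProjection_mem_orthogonal v))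
  rw [map_sub, map_sub, starProjection_offDiagonal_starProjection hX, sub_zero] at h1
  exact h1

end OffDiagonal

/-! ### Identification of the generator with the second fundamental form -/

section Submanifolds

open Filter Topology

variable {n : ℕ} {M : Type*} [TopologicalSpace M] [ChartedSpace (EuclideanSpace ℝ (Fin n)) M]
  [IsManifold (𝓡 n) ∞ M] [RiemannianBundle (fun x : M => TangentSpace (𝓡 n) x)]
  [IsContMDiffRiemannianBundle (𝓡 n) ∞ (EuclideanSpace ℝ (Fin n))
    (fun x : M => TangentSpace (𝓡 n) x)]
  {k : ℕ} {L : Type*} [TopologicalSpace L] [ChartedSpace (EuclideanSpace ℝ (Fin k)) L]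
  [IsManifold (𝓡 k) ∞ L]
  {nabla : CovariantDerivative (𝓡 n) (EuclideanSpace ℝ (Fin n))
    (fun x : M => TangentSpace (𝓡 n) x)} {ι : C^∞⟮𝓡 k, L; 𝓡 n, M⟯} {x : L}

theorem projN_apply (v : TangentSpace (𝓡 n) (ι x)) : projN ι x v = v - projT ι x v :=
  Submodule.starProjection_orthogonal_val v

theorem projN_projT (v : TangentSpace (𝓡 n) (ι x)) : projN ι x (projT ι x v) = 0 :=
  (Submodule.starProjection_apply_eq_zero_iff _).2
    (Submodule.le_orthogonal_orthogonal _ (Submodule.starProjection_apply_mem _ v))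

theorem projN_projN (v : TangentSpace (𝓡 n) (ι x)) : projN ι x (projN ι x v) = projN ι x v :=
  Submodule.starProjection_eq_self_iff.2 (Submodule.starProjection_apply_mem _ v)

theorem inner_projN_left (v w : TangentSpace (𝓡 n) (ι x)) :
    ⟪projN ι x v, w⟫_ℝ = ⟪v, projN ι x w⟫_ℝ :=
  Submodule.inner_starProjection_left_eq_right _ v w

theorem projT_eq_self {v : TangentSpace (𝓡 n) (ι x)} (hv : v ∈ tangentPlane ι x) :
    projT ι x v = v :=
  Submodule.starProjection_eq_self_iff.2 hv

theorem projT_projT (v : TangentSpace (𝓡 n) (ι x)) : projT ι x (projT ι x v) = projT ι x v :=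
  projT_eq_self (Submodule.starProjection_apply_mem _ v)

theorem IsDiffSectionAt.sub {s t : ∀ y, TangentSpace (𝓡 n) (ι y)} (hs : IsDiffSectionAt ι s x)
    (ht : IsDiffSectionAt ι t x) : IsDiffSectionAt ι (fun y => s y - t y) x := by
  refine mdifferentiableAt_of_localRep (𝓡 n) _ (𝓡 k) (mdifferentiable_immersion ι x) ?_
  simp only [map_sub]
  exact (mdifferentiableAt_localRep (f := ι) (EuclideanSpace ℝ (Fin n)) hs).sub
    (mdifferentiableAt_localRep (f := ι) (EuclideanSpace ℝ (Fin n)) ht)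

theorem IsDiffSectionAt.projN {s : ∀ y, TangentSpace (𝓡 n) (ι y)} (hs : IsDiffSectionAt ι s x)
    (ht : IsDiffSectionAt ι (fun y => projT ι y (s y)) x) :
    IsDiffSectionAt ι (fun y => projN ι y (s y)) x := by
  simpa only [projN_apply] using hs.sub ht

theorem connE_projN {s : ∀ y, TangentSpace (𝓡 n) (ι y)} (hs : IsDiffSectionAt ι s x)
    (ht : IsDiffSectionAt ι (fun y => projT ι y (s y)) x) :
    connE nabla ι (fun y => projN ι y (s y)) x =
      connE nabla ι s x - connE nabla ι (fun y => projT ι y (s y)) x := by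
  rw [eq_sub_iff_add_eq, ← connE_add (hs.projN ht) ht]
  simp only [projN_apply, sub_add_cancel]

theorem projN_connHat (s : ∀ y, TangentSpace (𝓡 n) (ι y)) (u : TangentSpace (𝓡 k) x) :
    projN ι x (connHat nabla ι s x u) =
      projN ι x (connE nabla ι (fun y => projN ι y (s y)) x u) := by
  have key : ∀ a b, projN ι x (projT ι x a + projN ι x b) = projN ι x b := fun a b => by
    rw [map_add, projN_projT, projN_projN, zero_add]
  exact key _ _

section Generator

variable {u : TangentSpace (𝓡 k) x}
  {X : TangentSpace (𝓡 n) (ι x) →L[ℝ] TangentSpace (𝓡 n) (ι x)}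

theorem IsProjectionGenerator.projT_apply (hX : IsProjectionGenerator nabla ι x u X)
    (v : TangentSpace (𝓡 n) (ι x)) : projT ι x (X v) = X v - X (projT ι x v) :=
  starProjection_offDiagonal hX.1 v

theorem IsProjectionGenerator.projT_apply_projT (hX : IsProjectionGenerator nabla ι x u X)
    (v : TangentSpace (𝓡 n) (ι x)) : projT ι x (X (projT ι x v)) = 0 :=
  starProjection_offDiagonal_starProjection hX.1 v

theorem IsProjectionGenerator.connE_projT (hX : IsProjectionGenerator nabla ι x u X)
    {s : ∀ y, TangentSpace (𝓡 n) (ι y)} (hs : IsDiffSectionAt ι s x) :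
    connE nabla ι (fun y => projT ι y (s y)) x u =
      projT ι x (connE nabla ι s x u) + (X (projT ι x (s x)) - projT ι x (X (s x))) :=
  (hX.2 s hs).2

/-- Expanding the two summands gives `∇̄_u s + (2π - 1)[X, π] s`. Since `πXπ = 0` and `πX = X - Xπ`,
the correction collapses to `-X s`. -/
theorem IsProjectionGenerator.connHat_apply (hX : IsProjectionGenerator nabla ι x u X)
    {s : ∀ y, TangentSpace (𝓡 n) (ι y)} (hs : IsDiffSectionAt ι s x) :
    connHat nabla ι s x u = connE nabla ι s x u - X (s x) := by
  have h1 := hX.connE_projT hs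
  change projT ι x (connE nabla ι (fun y => projT ι y (s y)) x u) +
    projN ι x (connE nabla ι (fun y => projN ι y (s y)) x u) = _
  rw [connE_projN hs (hX.2 s hs).1, projN_apply, sub_apply, h1]
  simp only [map_add, map_sub, hX.projT_apply, projT_projT]
  abel

/-- For a tangent section `πs = s`, so the equation for `∇̄_u (πs)` reads `∇̄_u s = π ∇̄_u s + X s`:
the normal part is `X s`. -/
theorem IsProjectionGenerator.coe_shapeMap (hX : IsProjectionGenerator nabla ι x u X)
    (hι : ∀ x, Function.Injective (mfderiv (𝓡 k) (𝓡 n) ι x)) (w : tangentPlane ι x) :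
    (shapeMap nabla ι hι x u w : TangentSpace (𝓡 n) (ι x)) = X w := by
  obtain ⟨v, rfl⟩ := (LinearEquiv.ofInjective (mfderiv (𝓡 k) (𝓡 n) ι x :
    TangentSpace (𝓡 k) x →ₗ[ℝ] TangentSpace (𝓡 n) (ι x)) (hι x)).surjective w
  let s : ∀ y, TangentSpace (𝓡 n) (ι y) := fun y =>
    mfderiv (𝓡 k) (𝓡 n) ι y (localExt (EuclideanSpace ℝ (Fin k)) (fun x : L => x) v y)
  have hs : IsDiffSectionAt ι s x := mdifferentiableAt_pushforward ι v
  have hsT : ∀ y, projT ι y (s y) = s y := fun y => projT_eq_self ⟨_, rfl⟩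
  have hsx : s x = mfderiv (𝓡 k) (𝓡 n) ι x v := by
    simp only [s]
    rw [localExt_self]
  have h1 := hX.connE_projT hs
  simp only [hsT] at h1
  have h2 : projT ι x (X (s x)) = 0 := by
    rw [← hsT, hX.projT_apply_projT]
  rw [h2, sub_zero] at h1
  have h3 : (shapeMap nabla ι hι x u (LinearEquiv.ofInjective (mfderiv (𝓡 k) (𝓡 n) ι x :
      TangentSpace (𝓡 k) x →ₗ[ℝ] TangentSpace (𝓡 n) (ι x)) (hι x) v) : TangentSpace (𝓡 n) (ι x)) =
      projN ι x (connE nabla ι s x u) :=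
    congrArg (fun w => (secondFF nabla ι x u w : TangentSpace (𝓡 n) (ι x)))
      (LinearEquiv.symm_apply_apply _ v)
  rw [h3, projN_apply, sub_eq_iff_eq_add, add_comm]
  rw [hsx] at h1
  exact h1

/-- A skew off-diagonal endomorphism is determined by its block from tangent to normal vectors,
which is `A_u`; skewness makes the other block `-A_u^*`. -/
theorem IsProjectionGenerator.packagedFF_eq (hX : IsProjectionGenerator nabla ι x u X)
    (hι : ∀ x, Function.Injective (mfderiv (𝓡 k) (𝓡 n) ι x)) :
    packagedFF nabla ι hι x u = X := by
  ext w
  refine ext_inner_right ℝ fun z => ?_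
  let W := tangentPlane ι x
  have h1 : packagedFF nabla ι hι x u w =
      (shapeMap nabla ι hι x u (W.orthogonalProjectionOnto w) : TangentSpace (𝓡 n) (ι x)) -
        ((shapeMap nabla ι hι x u).adjoint (Wᗮ.orthogonalProjectionOnto w) :
          TangentSpace (𝓡 n) (ι x)) := rfl
  have h2 : ⟪((shapeMap nabla ι hι x u).adjoint (Wᗮ.orthogonalProjectionOnto w) :
      TangentSpace (𝓡 n) (ι x)), z⟫_ℝ = ⟪w, X (projT ι x z)⟫_ℝ := by
    have h3 : ⟪((shapeMap nabla ι hι x u).adjoint (Wᗮ.orthogonalProjectionOnto w) :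
        TangentSpace (𝓡 n) (ι x)), z⟫_ℝ =
        ⟪(shapeMap nabla ι hι x u).adjoint (Wᗮ.orthogonalProjectionOnto w),
          W.orthogonalProjectionOnto z⟫_ℝ :=
      (Submodule.inner_orthogonalProjectionOnto_eq_of_mem_left _ _).symm
    rw [h3, LinearMap.adjoint_inner_left]
    refine (Submodule.inner_orthogonalProjectionOnto_eq_of_mem_right _ _).trans ?_
    rw [hX.coe_shapeMap hι]
    rfl
  have h4 : ⟪w, X (projT ι x z)⟫_ℝ = - ⟪projT ι x (X w), z⟫_ℝ := by
    have h5 := hX.1.1 w (projT ι x z)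
    have h6 : ⟪projT ι x (X w), z⟫_ℝ = ⟪X w, projT ι x z⟫_ℝ :=
      Submodule.inner_starProjection_left_eq_right _ _ _
    linarith
  have h7 : (shapeMap nabla ι hι x u (W.orthogonalProjectionOnto w) : TangentSpace (𝓡 n) (ι x)) =
      X (projT ι x w) := hX.coe_shapeMap hι _
  rw [h1, inner_sub_left, h2, h4, h7, hX.projT_apply, inner_sub_left]
  ring

end Generator

/-- The connections `∇̂` and `∇̄` differ by `X` in the direction `u`, and `X` annihilates the form.
-/
theorem IsParallelMultilinearAt.connHat {m : ℕ}
    {β : ∀ y, ContinuousMultilinearMap ℝ (fun _ : Fin m => TangentSpace (𝓡 n) (ι y)) ℝ}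
    (hβ : IsParallelMultilinearAt (𝓡 n) (EuclideanSpace ℝ (Fin n)) (𝓡 k) (connE nabla ι) β x)
    (h : ∀ u, ∃ X, IsProjectionGenerator nabla ι x u X ∧ ∀ v, derivAction X (β x) v = 0) :
    IsParallelMultilinearAt (𝓡 n) (EuclideanSpace ℝ (Fin n)) (𝓡 k) (connHat nabla ι) β x := by
  intro s hs
  refine (hβ s hs).congr_deriv fun u => ?_
  obtain ⟨X, hX, hXβ⟩ := h u
  have h1 := hXβ fun i => s i x
  have h2 : ∀ i, Calibrated.connHat nabla ι (s i) x u = connE nabla ι (s i) x u - X (s i x) :=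
    fun i => hX.connHat_apply (hs i)
  simp only [derivAction] at h1
  simp [h2, Finset.sum_sub_distrib, h1]

/-- The normal part of the metric. -/
noncomputable def normalMetric (ι : C^∞⟮𝓡 k, L; 𝓡 n, M⟯) (y : L) :
    ContinuousMultilinearMap ℝ (fun _ : Fin 2 => TangentSpace (𝓡 n) (ι y)) ℝ :=
  (innerMultilinear (TangentSpace (𝓡 n) (ι y))).compContinuousLinearMap fun _ => projN ι y

theorem normalMetric_apply (v : Fin 2 → TangentSpace (𝓡 n) (ι x)) :
    normalMetric ι x v = ⟪projN ι x (v 0), projN ι x (v 1)⟫_ℝ := rfl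

/-- Apply compatibility of `∇̄` with the metric to the normal parts of the sections; paired with
normal vectors, `∇̄` of a normal part and `∇̂` agree. -/
theorem isParallelMultilinearAt_normalMetric (h : nabla.IsMetricCompatible)
    (hT : ∀ s, IsDiffSectionAt ι s x → IsDiffSectionAt ι (fun y => projT ι y (s y)) x) :
    IsParallelMultilinearAt (𝓡 n) (EuclideanSpace ℝ (Fin n)) (𝓡 k) (connHat nabla ι)
      (normalMetric ι) x := by
  intro s hs
  have hs' : ∀ i, IsDiffSectionAt ι (s i) x := hs
  refine (isParallelMultilinearAt_inner_connE h x (fun i y => projN ι y (s i y))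
    fun i => (hs' i).projN (hT _ (hs i))).congr_deriv fun u => ?_
  simp only [Fin.sum_univ_two, add_apply, ContinuousLinearMap.comp_apply,
    ContinuousMultilinearMap.toContinuousLinearMap_apply, innerMultilinear_apply,
    normalMetric_apply]
  simp [inner_projN_left, projN_projN]
  refine congrArg₂ (· + ·) ?_ ?_
  · rw [← inner_projN_left (connHat nabla ι (s 0) x u), projN_connHat, inner_projN_left]
  · rw [projN_connHat]

end Submanifolds

end Calibrated

namespace Calibrated

/-! ### Consequences for calibrated immersions -/

section CalibratedSubmanifolds

variable {n : ℕ} {M : Type*} [TopologicalSpace M] [ChartedSpace (EuclideanSpace ℝ (Fin n)) M]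
  [IsManifold (𝓡 n) ∞ M] [RiemannianBundle (fun x : M => TangentSpace (𝓡 n) x)]
  [IsContMDiffRiemannianBundle (𝓡 n) ∞ (EuclideanSpace ℝ (Fin n))
    (fun x : M => TangentSpace (𝓡 n) x)]
  {k : ℕ} {L : Type*} [TopologicalSpace L] [ChartedSpace (EuclideanSpace ℝ (Fin k)) L]
  [IsManifold (𝓡 k) ∞ L]
  {nabla : CovariantDerivative (𝓡 n) (EuclideanSpace ℝ (Fin n))
    (fun x : M => TangentSpace (𝓡 n) x)} {ι : C^∞⟮𝓡 k, L; 𝓡 n, M⟯}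
  {N : ℕ} {deg : Fin (N + 1) → ℕ}
  {α : ∀ j, ∀ x : M, TangentSpace (𝓡 n) x [⋀^Fin (deg j)]→L[ℝ] ℝ}

theorem IsParallelMultilinearAt.isParallelForm {m : ℕ}
    {D : (∀ y, TangentSpace (𝓡 n) (ι y)) → ∀ y : L,
      TangentSpace (𝓡 k) y →L[ℝ] TangentSpace (𝓡 n) (ι y)}
    {β : ∀ y : L, TangentSpace (𝓡 n) (ι y) [⋀^Fin m]→L[ℝ] ℝ}
    (h : ∀ x, IsParallelMultilinearAt (𝓡 n) (EuclideanSpace ℝ (Fin n)) (𝓡 k) D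
      (fun y => (β y).toContinuousMultilinearMap) x) :
    IsParallelForm (𝓡 n) (EuclideanSpace ℝ (Fin n)) (𝓡 k) D β := by
  intro x u s hs
  have h1 := congrArg (fun A : TangentSpace (𝓡 k) x →L[ℝ] ℝ => A u) (h x s hs).mvfderiv
  refine h1.trans ?_
  simp

theorem holHat_subset_stabPlane {p : ∀ z : M, EuclideanSpace ℝ (Fin n) ≃ₗᵢ[ℝ] TangentSpace (𝓡 n) z}
    (hinner : ∀ y, IsParallelMultilinearAt (𝓡 n) (EuclideanSpace ℝ (Fin n)) (𝓡 k)
      (connHat nabla ι) (fun y => innerMultilinear (TangentSpace (𝓡 n) (ι y))) y)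
    (hnormal : ∀ y, IsParallelMultilinearAt (𝓡 n) (EuclideanSpace ℝ (Fin n)) (𝓡 k)
      (connHat nabla ι) (normalMetric ι) y)
    (hvol : ∀ y, IsParallelMultilinearAt (𝓡 n) (EuclideanSpace ℝ (Fin n)) (𝓡 k)
      (connHat nabla ι) (fun y => frameVolume (p (ι y))) y)
    (hα : ∀ j y, IsParallelMultilinearAt (𝓡 n) (EuclideanSpace ℝ (Fin n)) (𝓡 k)
      (connHat nabla ι) (fun y => (α j (ι y)).toContinuousMultilinearMap) y) (x : L) :
    holHat nabla ι x ⊆ stabPlane (fun j => α j (ι x)) (tangentPlane ι x) := by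
  intro T hT
  have hι := mdifferentiable_immersion ι
  have h1 : ∀ v w, ⟪T v, T w⟫_ℝ = ⟪v, w⟫_ℝ := fun v w =>
    restrictedHolonomy_preserves hinner hι hT ![v, w]
  refine ⟨⟨h1, ?_, fun j v => restrictedHolonomy_preserves (hα j) hι hT v⟩,
    map_eq_of_mapsTo h1 fun v hv => ?_⟩
  · have h2 := restrictedHolonomy_preserves hvol hι hT
      fun i => p (ι x) (EuclideanSpace.basisFun (Fin n) ℝ i)
    rwa [frameVolume_comp, frameVolume_self, mul_one] at h2
  -- Tangent vectors are the null vectors of the normal metric, so its invariance forces `T` to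
  -- preserve the tangent plane.
  · have h2 : ⟪projN ι x (T v), projN ι x (T v)⟫_ℝ = ⟪projN ι x v, projN ι x v⟫_ℝ :=
      restrictedHolonomy_preserves hnormal hι hT ![v, v]
    have h3 : projN ι x v = 0 := by rw [projN_apply, projT_eq_self hv, sub_self]
    rw [h3, inner_zero_left] at h2
    have h4 := inner_self_eq_zero.1 h2
    rw [projN_apply, sub_eq_zero] at h4
    rw [h4]
    exact Submodule.starProjection_apply_mem _ _

theorem IsParallelCompliant.isParallelMultilinearAt_connHat
    (hα : IsParallelCompliant nabla α) (h : nabla.IsMetricCompatible)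
    (hι : ∀ x, Function.Injective (mfderiv (𝓡 k) (𝓡 n) ι x))
    (hL : ∀ x, IsCalibratedPlane (α 0 (ι x)) (tangentPlane ι x)) (j : Fin (N + 1)) (x : L) :
    IsParallelMultilinearAt (𝓡 n) (EuclideanSpace ℝ (Fin n)) (𝓡 k) (connHat nabla ι)
      (fun y => (α j (ι y)).toContinuousMultilinearMap) x := by
  refine (hα.isParallelMultilinearAt_connE j x).connHat fun u => ?_
  obtain ⟨X, hX, hX'⟩ := hα.exists_projectionGenerator h hι hL x u
  exact ⟨X, hX', hX.2 j⟩

theorem IsParallelCompliant.packagedFF_mem_infStab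
    (hα : IsParallelCompliant nabla α) (h : nabla.IsMetricCompatible)
    (hι : ∀ x, Function.Injective (mfderiv (𝓡 k) (𝓡 n) ι x))
    (hL : ∀ x, IsCalibratedPlane (α 0 (ι x)) (tangentPlane ι x)) (x : L) (u : TangentSpace (𝓡 k) x) :
    packagedFF nabla ι hι x u ∈ infStab (fun j => α j (ι x)) := by
  obtain ⟨X, hX, hX'⟩ := hα.exists_projectionGenerator h hι hL x u
  rwa [hX'.packagedFF_eq hι]

theorem IsParallelCompliant.holHat_subset
    (hα : IsParallelCompliant nabla α) (h : nabla.IsMetricCompatible)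
    (hι : ∀ x, Function.Injective (mfderiv (𝓡 k) (𝓡 n) ι x))
    (hL : ∀ x, IsCalibratedPlane (α 0 (ι x)) (tangentPlane ι x)) (x : L) :
    holHat nabla ι x ⊆ stabPlane (fun j => α j (ι x)) (tangentPlane ι x) := by
  obtain ⟨a, Q, hQ⟩ := hα.gStructure
  choose p hp using hQ.nonempty
  refine holHat_subset_stabPlane (p := p) (fun y => ?_) (fun y => ?_) (fun y => ?_)
    (hα.isParallelMultilinearAt_connHat h hι hL) x
  · refine (isParallelMultilinearAt_inner_connE h y).connHat fun u => ?_
    obtain ⟨X, hX, hX'⟩ := hα.exists_projectionGenerator h hι hL y u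
    exact ⟨X, hX', hX.1⟩
  · refine isParallelMultilinearAt_normalMetric h fun s hs => ?_
    -- Only differentiability of the projected section is extracted, so any direction serves.
    obtain ⟨X, hX, hX'⟩ := hα.exists_projectionGenerator h hι hL y 0
    exact (hX'.2 s hs).1
  · obtain ⟨R, hR, hRα, hRvol⟩ := hQ.exists_localFrame hp ι y
    refine (hR.isParallelMultilinearAt h hRvol fun u w =>
      derivAction_frameVolume (hα.frameForm_mem_infStab h hR hRα u) _ w).connHat fun u => ?_
    obtain ⟨X, hX, hX'⟩ := hα.exists_projectionGenerator h hι hL y u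
    exact ⟨X, hX', derivAction_frameVolume hX _⟩

end CalibratedSubmanifolds

end Calibrated

/-! ### The theorem -/

theorem theorem3 {n N : ℕ} {deg : Fin (N + 1) → ℕ} (hk : 1 ≤ deg 0) (hkn : deg 0 < n)
    {M : Type*} [TopologicalSpace M] [T2Space M] [ChartedSpace (EuclideanSpace ℝ (Fin n)) M]
    [IsManifold (𝓡 n) ∞ M] [RiemannianBundle (fun x : M => TangentSpace (𝓡 n) x)]
    [IsContMDiffRiemannianBundle (𝓡 n) ∞ (EuclideanSpace ℝ (Fin n))
      (fun x : M => TangentSpace (𝓡 n) x)]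
    (nabla : CovariantDerivative (𝓡 n) (EuclideanSpace ℝ (Fin n))
      (fun x : M => TangentSpace (𝓡 n) x))
    (hnabla : Calibrated.IsLeviCivita nabla)
    (α : ∀ j, ∀ x : M, TangentSpace (𝓡 n) x [⋀^Fin (deg j)]→L[ℝ] ℝ)
    (hα : Calibrated.IsParallelCompliant nabla α)
    {L : Type*} [TopologicalSpace L] [T2Space L]
    [ChartedSpace (EuclideanSpace ℝ (Fin (deg 0))) L] [IsManifold (𝓡 (deg 0)) ∞ L]
    (ι : C^∞⟮𝓡 (deg 0), L; 𝓡 n, M⟯)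
    (hι : ∀ x, Function.Injective (mfderiv (𝓡 (deg 0)) (𝓡 n) ι x))
    (hL : ∀ x, Calibrated.IsCalibratedPlane (α 0 (ι x)) (Calibrated.tangentPlane ι x)) :
    (∀ j, Calibrated.IsParallelForm (𝓡 n) (EuclideanSpace ℝ (Fin n)) (𝓡 (deg 0))
      (Calibrated.connHat nabla ι) (fun x => α j (ι x))) ∧
    (∀ j (x : L) (u : TangentSpace (𝓡 (deg 0)) x),
      Calibrated.diamond (Calibrated.packagedFF nabla ι hι x u) (α j (ι x)) = 0) ∧
    (∀ x : L, Calibrated.holHat nabla ι x ⊆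
      Calibrated.stabPlane (fun j => α j (ι x)) (Calibrated.tangentPlane ι x)) ∧
    (∀ x : L, Calibrated.lieAlg (Calibrated.holHat nabla ι x) ⊆ Calibrated.lieAlg
      (Calibrated.stabPlane (fun j => α j (ι x)) (Calibrated.tangentPlane ι x))) ∧
    (∀ (x : L) (u : TangentSpace (𝓡 (deg 0)) x),
      Calibrated.packagedFF nabla ι hι x u ∈
        Calibrated.lieAlg (Calibrated.stabGroup (fun j => α j (ι x)))) := by
  refine ⟨fun j => Calibrated.IsParallelMultilinearAt.isParallelForm
      (hα.isParallelMultilinearAt_connHat hnabla.metric hι hL j), fun j x u => ?_,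
    hα.holHat_subset hnabla.metric hι hL,
    fun x X hX t => hα.holHat_subset hnabla.metric hι hL x (hX t),
    fun x u => Calibrated.mem_lieAlg_stabGroup_iff.2
      (hα.packagedFF_mem_infStab hnabla.metric hι hL x u)⟩
  rw [Calibrated.diamond_eq_derivAction]
  exact funext ((hα.packagedFF_mem_infStab hnabla.metric hι hL x u).2 j)
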